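/- Model. Let $G$ be a simple connected graph with $n\ge 1$ nodes. Nodes are anonymous and have no memory; the edges at each node $v$ are labelled arbitrarily by the port numbers $0,\dots,\deg(v)-1$. There are $n$ deterministic mobile agents with pairwise distinct identifiers in $\{0,1,\dots,\lambda\}$, placed one per node (dispersed initial configuration). They all run the same program and proceed in synchronous rounds. In each round every agent (i) exchanges messages with the agents at the same node, (ii) computes, from its memory, these messages, the degree of its node and the port through which it has just entered the node, a new memory content, and (iii) stays or moves through a port of its node. A terminated agent stays where it is and does not change its memory any more. The memory of an agent includes the space in which it processes the messages, which it reads one after the other in arbitrary order. Theorem. There are a family of agent programs, one for each $\lambda\in\mathbb N$, depending on $\lambda$ only (so the agents have no knowledge of any global parameter except the upper bound $\lambda$ on the identifiers), and a constant $C$ such that, for every such graph, port labelling, dispersed placement of $n$ agents and assignment of distinct identifiers in $\{0,\dots,\lambda\}$, within $C\,n\log(\lambda+2)=O(n\log\lambda)$ rounds all agents have terminated, each at its initial node, and their outputs satisfy the following: exactly one agent, the one with the smallest identifier, declares itself the leader, and there is a spanning tree $T$ of $G$, rooted at the node of the leader, such that the leader outputs that it has no parent and every other agent outputs the port of its node that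 leads to the parent of that node in $T$. Moreover each agent uses $O(\log n)$ bits of memory when identifiers are polynomially bounded: for every $k$ there is a constant $M$ such that, for all $n\ge1$ and all $\lambda\le (n+1)^{k}$, the program for $\lambda$ uses at most $M\log(n+1)$ bits of memory per agent. -/

import Mathlib

/-- A port numbering of a simple graph `G`: the edges at a node `v` are numbered bijectively by
`0, …, deg v - 1` (so `deg v` is the degree of `v`). The numberings at the two ends of an edge are
unrelated. -/
structure PortNumbering {V : Type} (G : SimpleGraph V) where
  deg : V → ℕ
  port : (v : V) → Fin (deg v) ≃ G.neighborSet v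

namespace PortNumbering

variable {V : Type} {G : SimpleGraph V} (N : PortNumbering G)

/-- The node at the other end of port `p` of `v`. -/
def nbr (v : V) (p : Fin (N.deg v)) : V := (N.port v p).1

/-- The number, at the other end of the edge, of the edge behind port `p` of `v`. -/
def entryPort (v : V) (p : Fin (N.deg v)) : Fin (N.deg (N.nbr v p)) :=
  (N.port (N.nbr v p)).symm ⟨v, SimpleGraph.Adj.symm (N.port v p).2⟩

/-- Effect of a move decision taken at the node `v`: the new node, and the port through which it was
entered (`none` for an agent that stays). The decision `some p` leads through port `p` (an agent
stays if there is no such port), the decision `none` is to stay. -/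
def traverse (v : V) : Option ℕ → V × Option ℕ
  | none => (v, none)
  | some p => if h : p < N.deg v then (N.nbr v ⟨p, h⟩, some (N.entryPort v ⟨p, h⟩)) else (v, none)

end PortNumbering

/-- What a terminated agent announces: whether it is the leader, and the port of its node that leads
to its parent in the tree (`none` if it has no parent). -/
structure AgentOutput where
  isLeader : Bool
  parent : Option ℕ

/-- What an agent senses at its current node: the degree of the node, and the port through which it
entered the node in the previous round (`none` if it did not move). -/
structure LocalView where
  deg : ℕ
  entry : Option ℕ

/-- A message exchanged between co-located agents: the whole memory of the sender and
the port through which the sender has just entered the node. -/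
structure AgentMessage (State : Type) where
  mem : State
  entry : Option ℕ

/-- The deterministic program that is run by every agent; `State` is the finite set of possible memory
contents. An agent with identifier `i` starts with memory `init i`. In each round it reads the
messages of the co-located agents one after the other, updating its memory by `recv`, so that the
processing of the messages takes place inside its memory as well, and then `act` yields its new
memory and its move. An agent whose memory `s` has `output s ≠ none` has terminated. -/
structure AgentProgram where
  State : Type
  fintypeState : Fintype State
  init : ℕ → State
  recv : LocalView → State → AgentMessage State → State
  act : LocalView → State → State × Option ℕ
  output : State → Option AgentOutput

namespace AgentProgram

/-- The number of bits that hold the memory of one agent. -/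
def memoryBits (P : AgentProgram) : ℕ := Nat.clog 2 (@Fintype.card P.State P.fintypeState)

/-- A global configuration of agents `A` on nodes `V` at the beginning of a round: node, entry port
and memory of each agent. -/
structure Config (P : AgentProgram) (V A : Type) where
  pos : A → V
  entry : A → Option ℕ
  mem : A → P.State

variable (P : AgentProgram) {V A : Type} {G : SimpleGraph V} (N : PortNumbering G)

/-- The initial configuration: agent `a` is at the node `start a` and knows its own identifier. -/
def initial (start : A → V) (ident : A → ℕ) : P.Config V A where
  pos := start
  entry := fun _ => none
  mem := fun a => P.init (ident a)

variable {P}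

/-- What agent `a` senses in the configuration `c`. -/
def Config.view (c : P.Config V A) (a : A) : LocalView := ⟨N.deg (c.pos a), c.entry a⟩

/-- The message sent by agent `a` in the configuration `c`. -/
def Config.message (c : P.Config V A) (a : A) : AgentMessage P.State := ⟨c.mem a, c.entry a⟩

/-- `l` lists the other agents at the node of `a`, each of them once. -/
def Config.IsReadingOrder (c : P.Config V A) (a : A) (l : List A) : Prop :=
  l.Nodup ∧ ∀ b, b ∈ l ↔ b ≠ a ∧ c.pos b = c.pos a

/-- The memory of `a` after it has read the messages of the agents in `l`. -/
def Config.memAfterReading (c : P.Config V A) (a : A) (l : List A) : P.State :=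
  l.foldl (fun s b => P.recv (c.view N a) s (c.message b)) (c.mem a)

/-- The configuration `c'` can follow `c` in one synchronous communicate-compute-move round.
A terminated agent keeps its node and its memory (which co-located agents can still read). Any other
agent reads the messages of all co-located agents, in an order that it cannot control, and acts. -/
def Config.Round (c c' : P.Config V A) : Prop :=
  ∀ a : A,
    (P.output (c.mem a) ≠ none ∧
      c'.mem a = c.mem a ∧ (c'.pos a, c'.entry a) = N.traverse (c.pos a) none) ∨
    (P.output (c.mem a) = none ∧
      ∃ l : List A, c.IsReadingOrder a l ∧
        c'.mem a = (P.act (c.view N a) (c.memAfterReading N a l)).1 ∧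
        (c'.pos a, c'.entry a) =
          N.traverse (c.pos a) (P.act (c.view N a) (c.memAfterReading N a l)).2)

variable (P)

/-- `c t` is the configuration after `t` rounds of an execution of the program `P`. -/
def IsExecution (start : A → V) (ident : A → ℕ) (c : ℕ → P.Config V A) : Prop :=
  c 0 = P.initial start ident ∧ ∀ t, (c t).Round N (c (t + 1))

end AgentProgram

/-- The outputs `out` of the agents, where agent `a` sits at the node `home a`, elect the agent with
the smallest identifier as the only leader, and describe a spanning tree `T` of `G` rooted at the
node of the leader: the leader has no parent, and the parent port of any other agent leads to its
neighbour in `T` that is one step closer to the root. -/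
def IsLeaderWithRootedSpanningTree {V A : Type} {G : SimpleGraph V} (N : PortNumbering G)
    (home : A → V) (ident : A → ℕ) (out : A → AgentOutput) : Prop :=
  ∃ r : A,
    (∀ a, ident r ≤ ident a) ∧
    (∀ a, (out a).isLeader = true ↔ a = r) ∧
    (out r).parent = none ∧
    ∃ T : SimpleGraph V, T ≤ G ∧ T.IsTree ∧
      ∀ a, a ≠ r → ∃ p : Fin (N.deg (home a)),
        (out a).parent = some (p : ℕ) ∧
        T.Adj (home a) (N.nbr (home a) p) ∧
        T.dist (N.nbr (home a) p) (home r) + 1 = T.dist (home a) (home r)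

/-! The agents guess the number `n` of nodes as `D = 2 ^ k`, in stages `k = 0, 1, …`. A stage has `6
* D` macro-rounds of `4 * B` rounds, where `B` is the length of the identifiers. In a macro-round
each agent is assigned one port; for each bit position and each value of the bit, the agents whose
identifier shows that value cross their port and return, while the others wait at home. Distinct
identifiers differ in some bit, so every agent meets the neighbour behind its port, at that
neighbour's home, in each macro-round (`exists_travels_of_ne`). Movement thus simulates message
passing over one port per agent and macro-round.

Macro-rounds below `3 * D` flood the smallest identifier, with depths and parent ports. A node
serves all its ports within as many macro-rounds as its degree, and balls around the minimum show
that `3 * n` macro-rounds suffice (`best_eq_min`). Up to `4 * D` each agent compares its `best` with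
all neighbours, and a mismatch raises a failure flag. Then only parent ports are used: failures
climb to the roots until `5 * D` and descend again until `6 * D`.

Safety is this argument read backwards. An agent without a flag at the end has a root without a flag
at `5 * D` (`exists_root`), so all agents of the tree of that root had no flag at `4 * D`
(`of_best_eq_root`). They agree with all their neighbours, and by connectivity the tree contains
every agent (`of_not_bad`). So all agents terminate together with a correct tree, or all go on; with
`n ≤ D` no failure arises (`not_bad`).

Stage lengths double and the last guess is below `2 * n`, so the time is `O(n * B)`. An agent stores
six numbers polynomial in `lam` and two flags. `StageTrace` separates the combinatorics from the
program; `StartsStage.trace` connects them. -/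

/-! ### Ports and degrees -/

namespace PortNumbering

variable {V : Type} {G : SimpleGraph V} (N : PortNumbering G)

/-- Port `p` of `v` exists and leads to `w`. -/
def Leads (v : V) (p : ℕ) (w : V) : Prop := ∃ h : p < N.deg v, N.nbr v ⟨p, h⟩ = w

variable {N}

theorem Leads.lt {v w : V} {p : ℕ} (h : N.Leads v p w) : p < N.deg v := h.1

theorem Leads.adj {v w : V} {p : ℕ} (h : N.Leads v p w) : G.Adj v w := by
  obtain ⟨h, rfl⟩ := h
  exact (N.port v ⟨p, h⟩).2

theorem exists_leads_of_adj {v w : V} (h : G.Adj v w) : ∃ p, N.Leads v p w := by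
  refine ⟨(N.port v).symm ⟨w, h⟩, Fin.is_lt _, ?_⟩
  simp [nbr]

/-- The return trip: an agent that remembers nothing but its entry port gets home by leaving through
it. -/
theorem Leads.traverse {v w : V} {p : ℕ} (h : N.Leads v p w) :
    ∃ q, N.traverse v (some p) = (w, some q) ∧ N.Leads w q v ∧
      N.traverse w (some q) = (v, some p) := by
  obtain ⟨h, rfl⟩ := h
  have key : N.nbr (N.nbr v ⟨p, h⟩) (N.entryPort v ⟨p, h⟩) = v := by
    change ((N.port _) ((N.port _).symm _)).1 = v
    rw [Equiv.apply_symm_apply]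
  refine ⟨N.entryPort v ⟨p, h⟩, by simp [PortNumbering.traverse, h], ⟨Fin.is_lt _, key⟩, ?_⟩
  have h1 : ∀ (x y : V) (q : Fin (N.deg y)) (r : Fin (N.deg x)), N.nbr y q = x →
      (N.port x r).1 = y → N.traverse y (some q) = (x, some (r : ℕ)) := by
    rintro x y q r rfl hr
    have : N.entryPort y q = r := by
      rw [entryPort, Equiv.symm_apply_eq]
      exact Subtype.ext hr.symm
    simp [PortNumbering.traverse, this]
  exact h1 _ _ _ ⟨p, h⟩ key rfl

theorem traverse_of_le {v : V} {p : ℕ} (h : N.deg v ≤ p) : N.traverse v (some p) = (v, none) := by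
  simp [traverse, h]

theorem traverse_eq_or (v : V) (o : Option ℕ) :
    N.traverse v o = (v, none) ∨ ∃ p w, o = some p ∧ N.Leads v p w := by
  rcases o with _ | p
  · exact .inl rfl
  · by_cases h : p < N.deg v
    · exact .inr ⟨p, _, rfl, h, rfl⟩
    · exact .inl (traverse_of_le (not_lt.mp h))

theorem deg_eq_card (v : V) : N.deg v = Nat.card (G.neighborSet v) := by
  rw [← Nat.card_congr (N.port v), Nat.card_eq_fintype_card, Fintype.card_fin]

theorem deg_lt_card [Fintype V] (v : V) : N.deg v < Fintype.card V := by
  rw [deg_eq_card, ← Nat.card_eq_fintype_card, Nat.card_coe_set_eq, ← Set.ncard_univ]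
  refine Set.ncard_lt_ncard ⟨Set.subset_univ _, fun h => ?_⟩ (Set.toFinite _)
  exact G.irrefl (h (Set.mem_univ v))

end PortNumbering

/-! ### Spanning trees from parent maps -/

namespace SimpleGraph

variable {V : Type} {G : SimpleGraph V}

/-- A parent map along which a depth function decreases by one describes a spanning tree. -/
theorem exists_isTree_of_parent [Fintype V] (r : V) (par : V → V) (dep : V → ℕ) (h0 : dep r = 0)
    (hadj : ∀ v, v ≠ r → G.Adj v (par v)) (hdep : ∀ v, v ≠ r → dep v = dep (par v) + 1) :
    ∃ T : SimpleGraph V, T ≤ G ∧ T.IsTree ∧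
      ∀ v, v ≠ r → T.Adj v (par v) ∧ T.dist (par v) r + 1 = T.dist v r := by
  classical
  let T : SimpleGraph V := SimpleGraph.fromRel fun v w => v ≠ r ∧ par v = w
  have hT : ∀ v, v ≠ r → T.Adj v (par v) := fun v hv =>
    (SimpleGraph.fromRel_adj _ _ _).2 ⟨(hadj v hv).ne, .inl ⟨hv, rfl⟩⟩
  have hTadj : ∀ v w, T.Adj v w → (v ≠ r ∧ par v = w) ∨ (w ≠ r ∧ par w = v) :=
    fun v w h => ((SimpleGraph.fromRel_adj _ _ _).1 h).2
  have hwalk : ∀ d v, dep v = d → ∃ p : T.Walk v r, p.length = d := by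
    intro d
    induction d with
    | zero =>
      intro v hv
      by_cases hr : v = r
      · subst hr
        exact ⟨.nil, rfl⟩
      · have := hdep v hr
        omega
    | succ d ih =>
      intro v hv
      have hr : v ≠ r := by
        rintro rfl
        omega
      obtain ⟨p, hp⟩ := ih (par v) (by have := hdep v hr; omega)
      exact ⟨.cons (hT v hr) p, by simp [hp]⟩
  -- Each edge of `T` changes `dep` by exactly one, so no walk to `r` is shorter than `dep`.
  have hle : ∀ v w (p : T.Walk v w), dep v ≤ dep w + p.length := by
    intro v w p
    induction p with
    | nil => simp
    | cons h p ih =>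
      rw [Walk.length_cons]
      rcases hTadj _ _ h with ⟨h1, h2⟩ | ⟨h1, h2⟩
      · have := hdep _ h1
        rw [h2] at this
        omega
      · have := hdep _ h1
        rw [h2] at this
        omega
  have hconn : T.Connected := by
    have : Nonempty V := ⟨r⟩
    refine SimpleGraph.Connected.mk fun v w => ?_
    obtain ⟨p, -⟩ := hwalk _ v rfl
    obtain ⟨q, -⟩ := hwalk _ w rfl
    exact ⟨p.append q.reverse⟩
  have hdist : ∀ v, T.dist v r = dep v := by
    intro v
    obtain ⟨p, hp⟩ := hwalk _ v rfl
    refine le_antisymm (hp ▸ dist_le p) ?_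
    obtain ⟨q, hq⟩ := hconn.exists_walk_length_eq_dist v r
    have := hle v r q
    omega
  refine ⟨T, ?_, ?_, fun v hv => ⟨hT v hv, by rw [hdist, hdist, hdep v hv]⟩⟩
  · intro v w h
    rcases hTadj v w h with ⟨h1, rfl⟩ | ⟨h1, rfl⟩
    · exact hadj _ h1
    · exact (hadj _ h1).symm
  · rw [isTree_iff_connected_and_card]
    refine ⟨hconn, le_antisymm ?_ hconn.card_vert_le_card_edgeSet_add_one⟩
    -- Every edge joins a non-root vertex to its parent, so a connected `T` has few enough edges to
    -- be a tree.
    have hsub : T.edgeSet ⊆ (fun v => s(v, par v)) '' {v | v ≠ r} := by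
      intro e
      induction e with
      | h v w =>
        intro h
        rcases hTadj v w h with ⟨h1, rfl⟩ | ⟨h1, rfl⟩
        · exact ⟨v, h1, rfl⟩
        · exact ⟨w, h1, Sym2.eq_swap⟩
    have h1 : T.edgeSet.ncard ≤ ({v | v ≠ r} : Set V).ncard :=
      (Set.ncard_le_ncard hsub (Set.toFinite _)).trans (Set.ncard_image_le (Set.toFinite _))
    have h2 : ({v | v ≠ r} : Set V).ncard < (Set.univ : Set V).ncard :=
      Set.ncard_lt_ncard ⟨Set.subset_univ _, fun h => h (Set.mem_univ r) rfl⟩ (Set.toFinite _)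
    rw [Set.ncard_univ] at h2
    rw [Nat.card_coe_set_eq]
    omega

end SimpleGraph

/-! ### The schedule of journeys -/

/-- Whether the agent with identifier `i` leaves its home in the slot of round `τ` of a stage: slots
run through the `B` bits of the identifiers and both values of a bit. -/
def travels (B i τ : ℕ) : Bool := i.testBit (τ / 4 % B) == decide (τ / 2 % 2 = 1)

theorem exists_travels_of_ne {B i j : ℕ} (hi : i < 2 ^ B) (hj : j < 2 ^ B) (hij : i ≠ j) (μ : ℕ) :
    ∃ τ, 4 * B * μ ≤ τ ∧ τ < 4 * B * (μ + 1) ∧ τ / (4 * B) = μ ∧ τ % 2 = 1 ∧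
      travels B i τ = true ∧ travels B j τ = false := by
  obtain ⟨b, hb⟩ : ∃ b, i.testBit b ≠ j.testBit b := by
    by_contra! h
    exact hij (Nat.eq_of_testBit_eq h)
  have hbB : b < B := by
    by_contra! h
    have h2 : 2 ^ B ≤ 2 ^ b := Nat.pow_le_pow_right (by norm_num) h
    rw [Nat.testBit_lt_two_pow (hi.trans_le h2), Nat.testBit_lt_two_pow (hj.trans_le h2)] at hb
    exact hb rfl
  obtain ⟨e, he, heb⟩ : ∃ e, e < 2 ∧ i.testBit b = decide (e = 1) := by
    rcases h : i.testBit b with _ | _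
    · exact ⟨0, by norm_num, by simp⟩
    · exact ⟨1, by norm_num, by simp⟩
  -- The witness is the second, odd round of the slot for bit `b` and value `e` in macro-round `μ`:
  -- the travellers are then away.
  have h4 : (4 * (B * μ + b) + 2 * e + 1) / 4 = B * μ + b := by omega
  have h5 : (4 * (B * μ + b) + 2 * e + 1) / 2 % 2 = e := by omega
  have h6 : (B * μ + b) % B = b := by rw [Nat.mul_add_mod, Nat.mod_eq_of_lt hbB]
  have hlo : 4 * B * μ ≤ 4 * (B * μ + b) + 2 * e + 1 := by nlinarith
  have hhi : 4 * (B * μ + b) + 2 * e + 1 < 4 * B * (μ + 1) := by nlinarith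
  refine ⟨4 * (B * μ + b) + 2 * e + 1, hlo, hhi, ?_, by omega, ?_, ?_⟩
  · exact Nat.div_eq_of_lt_le (by linarith) (by linarith)
  · simp [travels, h4, h5, h6, heb]
  · rw [travels, h4, h5, h6, ← heb]
    simpa using hb.symm

open PortNumbering

/-- A node of degree `d` serves each of its ports in any `d` consecutive macro-rounds, wherever they
begin. -/
theorem exists_mod_eq {p d : ℕ} (h : p < d) (n : ℕ) : ∃ μ, n ≤ μ ∧ μ < n + d ∧ μ % d = p := by
  have := Finset.mem_range.2 h
  rw [← Nat.image_Ico_mod n d, Finset.mem_image] at this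
  obtain ⟨μ, h1, h2⟩ := this
  rw [Finset.mem_Ico] at h1
  exact ⟨μ, h1.1, h1.2, h2⟩

/-! ### Combinatorial analysis of one stage -/

/-- The port that agent `a` uses in the slots of round `τ` of a stage: all ports in turn at first,
and the port to the parent in the last third of the stage. -/
def chosenPort (B D deg τ : ℕ) (parent : Option ℕ) : Option ℕ :=
  if τ / (4 * B) < 4 * D then some (τ / (4 * B) % deg) else parent

/-- What happens in the rounds `τ ≤ 24 * B * D` of a stage, in terms of the smallest known identifier
`best`, the depth, the parent port and the failure flag of the agents. -/
structure StageTrace {V A : Type} {G : SimpleGraph V} (N : PortNumbering G) (start : A ≃ V)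
    (ident : A → ℕ) (B D : ℕ) (best depth : ℕ → A → ℕ) (parent : ℕ → A → Option ℕ)
    (bad : ℕ → A → Prop) : Prop where
  ident_lt : ∀ a, ident a < 2 ^ B
  injective : Function.Injective ident
  pos_bits : 0 < B
  best_zero : ∀ a, best 0 a = ident a
  depth_zero : ∀ a, depth 0 a = 0
  parent_zero : ∀ a, parent 0 a = none
  not_bad_zero : ∀ a, ¬ bad 0 a
  same : ∀ τ < 4 * B * (6 * D), τ % 2 = 0 ∨ 3 * D ≤ τ / (4 * B) → ∀ a,
    best (τ + 1) a = best τ a ∧ depth (τ + 1) a = depth τ a ∧ parent (τ + 1) a = parent τ a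
  flood : ∀ τ < 4 * B * (6 * D), τ % 2 = 1 → τ / (4 * B) < 3 * D → ∀ a,
    (best (τ + 1) a = best τ a ∧ depth (τ + 1) a = depth τ a ∧ parent (τ + 1) a = parent τ a) ∨
    ∃ b q, N.Leads (start a) q (start b) ∧ best τ b < best τ a ∧ depth τ b < D ∧
      best (τ + 1) a = best τ b ∧ depth (τ + 1) a = depth τ b + 1 ∧ parent (τ + 1) a = some q
  push : ∀ τ < 4 * B * (6 * D), τ % 2 = 1 → τ / (4 * B) < 3 * D → ∀ a b,
    travels B (ident b) τ = true → travels B (ident a) τ = false →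
    N.Leads (start b) (τ / (4 * B) % N.deg (start b)) (start a) → depth τ b < D →
    best (τ + 1) a ≤ best τ b
  bad_succ : ∀ τ < 4 * B * (6 * D), ∀ a, bad τ a → bad (τ + 1) a
  bad_of_deg : ∀ τ < 4 * B * (6 * D), τ % 2 = 0 → ∀ a, D < N.deg (start a) → bad (τ + 1) a
  bad_source : ∀ τ < 4 * B * (6 * D), ∀ a, bad (τ + 1) a →
    bad τ a ∨ D < N.deg (start a) ∨
      (3 * D ≤ τ / (4 * B) ∧ ∃ b, bad τ b ∨ best τ b ≠ best τ a)
  bad_meet : ∀ τ < 4 * B * (6 * D), τ % 2 = 1 → 3 * D ≤ τ / (4 * B) → ∀ a b p,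
    travels B (ident a) τ = true → travels B (ident b) τ = false →
    chosenPort B D (N.deg (start a)) τ (parent τ a) = some p → N.Leads (start a) p (start b) →
    (bad τ b ∨ best τ b ≠ best τ a → bad (τ + 1) a) ∧
    (bad τ a ∨ best τ a ≠ best τ b → bad (τ + 1) b)

namespace StageTrace

variable {V A : Type} {G : SimpleGraph V} {N : PortNumbering G} {start : A ≃ V}
  {ident : A → ℕ} {B D : ℕ} {best depth : ℕ → A → ℕ} {parent : ℕ → A → Option ℕ}
  {bad : ℕ → A → Prop}

/-- The neighbours of `x` lie at distances from `v` that differ by at most one from that of `x`,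
hence in the larger ball and outside the smaller one. -/
theorem deg_add_ncard_le [Fintype V] (hG : G.Connected) (v x : V) :
    N.deg x + {w | G.dist w v < G.dist x v - 1}.ncard ≤ {w | G.dist w v < G.dist x v + 2}.ncard := by
  rw [N.deg_eq_card, Nat.card_coe_set_eq, ← Set.ncard_union_eq _ (Set.toFinite _) (Set.toFinite _)]
  · refine Set.ncard_le_ncard ?_ (Set.toFinite _)
    rintro w (h | h)
    · have h1 := hG.dist_triangle (u := w) (v := x) (w := v)
      have h2 : G.dist w x = 1 := SimpleGraph.dist_eq_one_iff_adj.2 (SimpleGraph.Adj.symm h)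
      simp only [Set.mem_ofPred_eq]
      omega
    · simp only [Set.mem_ofPred_eq] at h ⊢
      omega
  · rw [Set.disjoint_left]
    intro w h h'
    have h1 := hG.dist_triangle (u := x) (v := w) (w := v)
    have h2 : G.dist x w = 1 := SimpleGraph.dist_eq_one_iff_adj.2 h
    simp only [Set.mem_ofPred_eq] at h'
    omega

theorem exists_adj_dist_eq (hG : G.Connected) {v w : V} {d : ℕ} (h : G.dist v w = d + 1) :
    ∃ u, G.Adj u v ∧ G.dist u w = d := by
  obtain ⟨p, hp⟩ := hG.exists_walk_length_eq_dist v w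
  rw [h] at hp
  cases p with
  | nil => simp at hp
  | @cons _ u _ hu p =>
    refine ⟨u, hu.symm, ?_⟩
    have h1 := SimpleGraph.dist_le p
    have h2 := hG.dist_triangle (u := v) (v := u) (w := w)
    have h3 : G.dist v u = 1 := SimpleGraph.dist_eq_one_iff_adj.2 hu
    rw [SimpleGraph.Walk.length_cons] at hp
    omega

section

variable (S : StageTrace N start ident B D best depth parent bad)

include S

theorem step {τ : ℕ} (hτ : τ < 4 * B * (6 * D)) (a : A) :
    (best (τ + 1) a = best τ a ∧ depth (τ + 1) a = depth τ a ∧ parent (τ + 1) a = parent τ a) ∨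
    ∃ b q, N.Leads (start a) q (start b) ∧ best τ b < best τ a ∧ depth τ b < D ∧
      best (τ + 1) a = best τ b ∧ depth (τ + 1) a = depth τ b + 1 ∧ parent (τ + 1) a = some q := by
  by_cases h : τ % 2 = 0 ∨ 3 * D ≤ τ / (4 * B)
  · exact .inl (S.same τ hτ h a)
  · push Not at h
    exact S.flood τ hτ (by omega) h.2 a

theorem best_succ_le {τ : ℕ} (hτ : τ < 4 * B * (6 * D)) (a : A) : best (τ + 1) a ≤ best τ a := by
  rcases S.step hτ a with h | ⟨b, q, -, h1, -, h2, -⟩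
  · exact h.1.le
  · omega

theorem best_anti {σ τ : ℕ} (h : σ ≤ τ) (hτ : τ ≤ 4 * B * (6 * D)) (a : A) :
    best τ a ≤ best σ a := by
  induction τ, h using Nat.le_induction with
  | base => rfl
  | succ τ _ ih => exact (S.best_succ_le hτ a).trans (ih (Nat.le_of_succ_le hτ))

theorem bad_mono {σ τ : ℕ} (h : σ ≤ τ) (hτ : τ ≤ 4 * B * (6 * D)) {a : A} (ha : bad σ a) :
    bad τ a := by
  induction τ, h using Nat.le_induction with
  | base => exact ha
  | succ τ _ ih => exact S.bad_succ τ hτ a (ih (Nat.le_of_succ_le hτ))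

/-- Depth and parent change only together with a strict decrease of `best`, which is never undone.
-/
theorem eq_of_best_eq {σ τ : ℕ} (h : σ ≤ τ) (hτ : τ ≤ 4 * B * (6 * D)) {a : A}
    (ha : best τ a = best σ a) : depth τ a = depth σ a ∧ parent τ a = parent σ a := by
  induction τ, h using Nat.le_induction with
  | base => exact ⟨rfl, rfl⟩
  | succ τ hle ih =>
    have h1 := S.best_anti hle (Nat.le_of_succ_le hτ) a
    have h2 := S.best_succ_le hτ a
    obtain ⟨h3, h4⟩ := ih (Nat.le_of_succ_le hτ) (by omega)
    rcases S.step hτ a with ⟨-, h5, h6⟩ | ⟨b, q, -, h5, -, h6, -⟩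
    · exact ⟨h5.trans h3, h6.trans h4⟩
    · omega

/-- After the flooding, nothing but the failure flags changes. -/
theorem frozen {σ τ : ℕ} (hσ : 4 * B * (3 * D) ≤ σ) (h : σ ≤ τ) (hτ : τ ≤ 4 * B * (6 * D)) (a : A) :
    best τ a = best σ a ∧ depth τ a = depth σ a ∧ parent τ a = parent σ a := by
  induction τ, h using Nat.le_induction with
  | base => exact ⟨rfl, rfl, rfl⟩
  | succ τ hle ih =>
    obtain ⟨h1, h2, h3⟩ := ih (Nat.le_of_succ_le hτ)
    have h4 : 3 * D ≤ τ / (4 * B) :=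
      (Nat.le_div_iff_mul_le (by have := S.pos_bits; omega)).2 (by linarith)
    obtain ⟨h5, h6, h7⟩ := S.same τ hτ (.inr h4) a
    exact ⟨h5.trans h1, h6.trans h2, h7.trans h3⟩

theorem best_eq_ident {τ : ℕ} (hτ : τ ≤ 4 * B * (6 * D)) (a : A) : ∃ b, best τ a = ident b := by
  induction τ generalizing a with
  | zero => exact ⟨a, S.best_zero a⟩
  | succ τ ih =>
    rcases S.step hτ a with h | ⟨b, q, -, -, -, h, -⟩
    · rw [h.1]
      exact ih (Nat.le_of_succ_le hτ) a
    · rw [h]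
      exact ih (Nat.le_of_succ_le hτ) b

theorem best_le_ident {τ : ℕ} (hτ : τ ≤ 4 * B * (6 * D)) (a : A) : best τ a ≤ ident a :=
  (S.best_anti (Nat.zero_le _) hτ a).trans (S.best_zero a).le

theorem depth_le {τ : ℕ} (hτ : τ ≤ 4 * B * (6 * D)) (a : A) : depth τ a ≤ D := by
  induction τ generalizing a with
  | zero => simp [S.depth_zero]
  | succ τ ih =>
    rcases S.step hτ a with h | ⟨b, q, -, -, h1, -, h2, -⟩
    · rw [h.2.1]
      exact ih (Nat.le_of_succ_le hτ) a
    · omega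

/-- A parent can only move on to a smaller identifier; as long as it has not, its depth is still the
one that the child read. -/
theorem parent_cases {τ : ℕ} (hτ : τ ≤ 4 * B * (6 * D)) (a : A) :
    (parent τ a = none ∧ depth τ a = 0 ∧ best τ a = ident a) ∨
    ∃ b q, parent τ a = some q ∧ N.Leads (start a) q (start b) ∧ best τ a < ident a ∧
      best τ b ≤ best τ a ∧ (best τ b = best τ a → depth τ a = depth τ b + 1) := by
  induction τ with
  | zero => exact .inl ⟨S.parent_zero a, S.depth_zero a, S.best_zero a⟩
  | succ τ ih =>
    have hb := fun b => S.best_succ_le hτ b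
    rcases S.step hτ a with ⟨h1, h2, h3⟩ | ⟨b, q, h1, h2, h3, h4, h5, h6⟩
    · rw [h1, h2, h3]
      rcases ih (Nat.le_of_succ_le hτ) with h | ⟨b, q, h4, h5, h6, h7, h8⟩
      · exact .inl h
      · refine .inr ⟨b, q, h4, h5, h6, (hb b).trans h7, fun h9 => ?_⟩
        have h10 : best (τ + 1) b = best τ b := by
          have := hb b
          omega
        rw [(S.eq_of_best_eq (Nat.le_succ τ) hτ h10).1]
        exact h8 (by omega)
    · have h7 := S.best_le_ident (Nat.le_of_succ_le hτ) a
      refine .inr ⟨b, q, h6, h1, by omega, h4 ▸ hb b, fun h9 => ?_⟩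
      have h10 : best (τ + 1) b = best τ b := h9.trans h4
      rw [h5, (S.eq_of_best_eq (Nat.le_succ τ) hτ h10).1]

theorem exists_depth {τ : ℕ} (hτ : τ ≤ 4 * B * (6 * D)) (a : A) {j : ℕ} (hj : j ≤ depth τ a) :
    ∃ σ ≤ τ, ∃ x, best σ x = best τ a ∧ depth σ x = j := by
  induction τ generalizing a j with
  | zero => exact ⟨0, le_rfl, a, rfl, by rw [S.depth_zero] at hj ⊢; omega⟩
  | succ τ ih =>
    rcases S.step hτ a with ⟨h1, h2, -⟩ | ⟨b, q, -, -, -, h1, h2, -⟩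
    · obtain ⟨σ, h3, x, h4, h5⟩ := ih (Nat.le_of_succ_le hτ) a (h2 ▸ hj)
      exact ⟨σ, by omega, x, h4.trans h1.symm, h5⟩
    · rcases Nat.lt_or_ge (depth τ b) j with h | h
      · exact ⟨τ + 1, le_rfl, a, rfl, by omega⟩
      · obtain ⟨σ, h3, x, h4, h5⟩ := ih (Nat.le_of_succ_le hτ) b h
        exact ⟨σ, by omega, x, h4.trans h1.symm, h5⟩

/-- Tracing an identifier back gives a holder of each smaller depth. These holders are distinct,
since an agent has only one depth per value of `best`. So the cap `D` on depths never stops the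
flooding when `n ≤ D`. -/
theorem depth_lt_card [Fintype V] {τ : ℕ} (hτ : τ ≤ 4 * B * (6 * D)) (a : A) :
    depth τ a < Fintype.card V := by
  have h : ∀ j : Fin (depth τ a + 1), ∃ σ ≤ τ, ∃ x, best σ x = best τ a ∧ depth σ x = j :=
    fun j => S.exists_depth hτ a (Nat.lt_succ_iff.1 j.2)
  choose σ hσ x h1 h2 using h
  have hinj : Function.Injective (start ∘ x) := by
    intro i j hij
    have hx : x i = x j := start.injective hij
    have key : ∀ i j, x i = x j → σ i ≤ σ j → (i : ℕ) = j := by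
      intro i j hx hle
      have h3 := (S.eq_of_best_eq hle ((hσ j).trans hτ) (a := x i)
        (by rw [h1 i]; rw [hx]; exact h1 j)).1
      rw [← h2 i, ← h2 j, ← h3, hx]
    rcases le_total (σ i) (σ j) with h | h
    · exact Fin.ext (key i j hx h)
    · exact Fin.ext (key j i hx.symm h).symm
  simpa using Fintype.card_le_of_injective _ hinj

/-- In each macro-round of the last two thirds of the stage that matters for the flags, an agent and
the agent behind its chosen port compare their memories. -/
theorem compare {μ : ℕ} (hμ : 3 * D ≤ μ) (hμ' : μ < 6 * D) {a b : A} {p : ℕ}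
    (hp : (if μ < 4 * D then some (μ % N.deg (start a)) else parent (4 * B * (3 * D)) a) = some p)
    (hl : N.Leads (start a) p (start b)) :
    (¬ bad (4 * B * (μ + 1)) a → ¬ bad (4 * B * μ) b ∧
      best (4 * B * (3 * D)) b = best (4 * B * (3 * D)) a) ∧
    (¬ bad (4 * B * (μ + 1)) b → ¬ bad (4 * B * μ) a) := by
  have hne : ident a ≠ ident b := fun h => hl.adj.ne (congrArg start (S.injective h))
  obtain ⟨τ, h1, h2, h3, h4, h5, h6⟩ := exists_travels_of_ne (S.ident_lt a) (S.ident_lt b) hne μ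
  have hend : 4 * B * (μ + 1) ≤ 4 * B * (6 * D) := Nat.mul_le_mul_left _ hμ'
  have hbeg : 4 * B * (3 * D) ≤ 4 * B * μ := Nat.mul_le_mul_left _ hμ
  have hτ : τ < 4 * B * (6 * D) := by omega
  have hfr := fun x => S.frozen le_rfl (hbeg.trans h1) hτ.le x
  have hm := S.bad_meet τ hτ h4 (by omega) a b p h5 h6
    (by rw [chosenPort, h3, (hfr a).2.2]; exact hp) hl
  rw [(hfr a).1, (hfr b).1] at hm
  refine ⟨fun hn => ⟨fun hb => hn ?_, ?_⟩, fun hn ha => hn ?_⟩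
  · exact S.bad_mono h2 hend (hm.1 (.inl (S.bad_mono h1 hτ.le hb)))
  · by_contra hb
    exact hn (S.bad_mono h2 hend (hm.1 (.inr hb)))
  · exact S.bad_mono h2 hend (hm.2 (.inl (S.bad_mono h1 hτ.le ha)))

/-- Having no flag implies degree at most `D`, so the `D` macro-rounds from `3 * D` on reach every
neighbour, and any mismatch would have been noticed. -/
theorem best_eq_of_adj (hD : 0 < D) {a b : A} (ha : ¬ bad (4 * B * (4 * D)) a)
    (hadj : G.Adj (start a) (start b)) :
    best (4 * B * (3 * D)) b = best (4 * B * (3 * D)) a := by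
  have hB := S.pos_bits
  obtain ⟨p, hp⟩ := N.exists_leads_of_adj hadj
  have hdeg : N.deg (start a) ≤ D := by
    by_contra! h
    refine ha (S.bad_mono (σ := 0 + 1) ?_ ?_ (S.bad_of_deg 0 (by positivity) rfl a h))
    · have : 0 < 4 * B * (4 * D) := by positivity
      omega
    · exact Nat.mul_le_mul_left _ (by omega)
  obtain ⟨μ, h1, h2, h3⟩ : ∃ μ, 3 * D ≤ μ ∧ μ < 4 * D ∧ μ % N.deg (start a) = p := by
    obtain ⟨μ, h1, h2, h3⟩ := exists_mod_eq hp.lt (3 * D)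
    exact ⟨μ, h1, by omega, h3⟩
  refine ((S.compare h1 (by omega) (b := b) (p := p) (by simp [h2, h3]) hp).1 fun h => ha ?_).2
  exact S.bad_mono (Nat.mul_le_mul_left _ h2) (Nat.mul_le_mul_left _ (by omega)) h

/-- Going one macro-round back in time allows one step up: an agent without a flag has just compared
with its parent, which had no flag either and has the same `best`, hence depth smaller by one.
Depths are at most `D`, so a root is reached no earlier than `5 * D`. -/
theorem exists_root (hD : 0 < D) : ∀ (d : ℕ) (v : A) (j : ℕ), depth (4 * B * (3 * D)) v = d →
    j + d ≤ D → ¬ bad (4 * B * (6 * D - j)) v →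
    ∃ r, best (4 * B * (3 * D)) r = ident r ∧ ¬ bad (4 * B * (5 * D)) r := by
  have hF : 4 * B * (3 * D) ≤ 4 * B * (6 * D) := Nat.mul_le_mul_left _ (by omega)
  have main : ∀ (v : A) (j : ℕ), j ≤ D → ¬ bad (4 * B * (6 * D - j)) v →
      (∃ r, best (4 * B * (3 * D)) r = ident r ∧ ¬ bad (4 * B * (5 * D)) r) ∨
      ∃ b, depth (4 * B * (3 * D)) v = depth (4 * B * (3 * D)) b + 1 ∧
        ¬ bad (4 * B * (6 * D - (j + 1))) b := by
    intro v j hj hv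
    rcases S.parent_cases hF v with ⟨-, -, h⟩ | ⟨b, q, h1, h2, -, -, h3⟩
    · refine .inl ⟨v, h, fun hb => hv (S.bad_mono ?_ ?_ hb)⟩ <;>
        exact Nat.mul_le_mul_left _ (by omega)
    · obtain ⟨μ, hμ⟩ : ∃ μ, 6 * D - j = μ + 1 := ⟨6 * D - j - 1, by omega⟩
      obtain ⟨h4, h5⟩ := (S.compare (μ := μ) (by omega) (by omega) (b := b) (p := q)
        (by rw [if_neg (by omega), h1]) h2).1 (hμ ▸ hv)
      exact .inr ⟨b, h3 h5, by rwa [show 6 * D - (j + 1) = μ by omega]⟩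
  intro d
  induction d with
  | zero =>
    intro v j hd hj hv
    rcases main v j (by omega) hv with h | ⟨b, h, -⟩
    · exact h
    · omega
  | succ d ih =>
    intro v j hd hj hv
    rcases main v j (by omega) hv with h | ⟨b, h, h'⟩
    · exact h
    · exact ih b (j + 1) (by omega) (by omega) h'

/-- If a root has not noticed a failure, then neither has any agent that ever knew its identifier
as the smallest one. -/
theorem of_best_eq_root (hD : 0 < D) {r : A} (hr : best (4 * B * (3 * D)) r = ident r)
    (hbad : ¬ bad (4 * B * (5 * D)) r) {σ : ℕ} (hσ : σ ≤ 4 * B * (3 * D)) {x : A}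
    (hx : best σ x = ident r) :
    best (4 * B * (3 * D)) x = ident r ∧
      ¬ bad (4 * B * (5 * D - depth (4 * B * (3 * D)) x)) x := by
  have hF : 4 * B * (3 * D) ≤ 4 * B * (6 * D) := Nat.mul_le_mul_left _ (by omega)
  induction σ generalizing x with
  | zero =>
    obtain rfl : x = r := S.injective (by rw [← hx, S.best_zero])
    refine ⟨hr, fun h => hbad (S.bad_mono ?_ ?_ h)⟩ <;> exact Nat.mul_le_mul_left _ (by omega)
  | succ σ ih =>
    rcases S.step (show σ < 4 * B * (6 * D) by omega) x with
      ⟨h1, -, -⟩ | ⟨u, q, h1, -, h2, h3, h4, h5⟩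
    · exact ih (by omega) (h1 ▸ hx)
    · obtain ⟨h6, h7⟩ := ih (x := u) (by omega) (h3 ▸ hx)
      have h8 := (S.eq_of_best_eq (by omega : σ ≤ 4 * B * (3 * D)) hF
        (by rw [h6, ← h3, hx] : best _ u = best σ u)).1
      have h9 : ¬ bad (4 * B * (4 * D)) u := fun h => h7 (S.bad_mono
        (Nat.mul_le_mul_left _ (by omega)) (Nat.mul_le_mul_left _ (by omega)) h)
      -- `x` cannot have switched to a smaller identifier later, because `u` has compared with all
      -- its neighbours, among them `x`.
      have h10 : best (4 * B * (3 * D)) x = ident r :=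
        (S.best_eq_of_adj hD h9 h1.adj.symm).trans h6
      obtain ⟨h11, h12⟩ := S.eq_of_best_eq hσ hF (h10.trans hx.symm)
      refine ⟨h10, ?_⟩
      -- In this macro-round `x` reports to its parent `u`, which has no flag when it ends.
      refine (S.compare (μ := 5 * D - depth (4 * B * (3 * D)) x) (by omega) (by omega)
        (a := x) (b := u) (p := q) (by rw [if_neg (by omega), h12, h5]) h1).2 ?_
      rwa [show 5 * D - depth (4 * B * (3 * D)) x + 1 = 5 * D - depth (4 * B * (3 * D)) u by omega]

/-- The agents agree on whether a stage has failed, and if it has not then they all know the smallest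
identifier. -/
theorem of_not_bad (hG : G.Connected) (hD : 0 < D) {v : A} (hv : ¬ bad (4 * B * (6 * D)) v) :
    (∀ x, ¬ bad (4 * B * (6 * D)) x) ∧ ∃ r, ∀ x, best (4 * B * (6 * D)) x = ident r := by
  have hF : 4 * B * (3 * D) ≤ 4 * B * (6 * D) := Nat.mul_le_mul_left _ (by omega)
  have hH : 4 * B * (4 * D) ≤ 4 * B * (6 * D) := Nat.mul_le_mul_left _ (by omega)
  obtain ⟨r, hr, hbad⟩ := S.exists_root hD _ v 0 rfl (by have := S.depth_le hF v; omega) hv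
  have hgood : ∀ x, best (4 * B * (3 * D)) x = ident r → ¬ bad (4 * B * (4 * D)) x := by
    intro x hx h
    refine (S.of_best_eq_root hD hr hbad le_rfl hx).2 (S.bad_mono ?_ ?_ h)
    · have := S.depth_le hF x
      exact Nat.mul_le_mul_left _ (by omega)
    · exact Nat.mul_le_mul_left _ (by omega)
  have hall : ∀ x, best (4 * B * (3 * D)) x = ident r := by
    -- The agents that know `r` are closed under adjacency.
    have key : ∀ v w (_ : G.Walk v w), best (4 * B * (3 * D)) (start.symm v) = ident r →
        best (4 * B * (3 * D)) (start.symm w) = ident r := by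
      intro v w p
      induction p with
      | nil => exact id
      | cons h p ih =>
        exact fun h1 => ih ((S.best_eq_of_adj hD (hgood _ h1) (by simpa using h)).trans h1)
    intro x
    obtain ⟨p⟩ := hG.preconnected (start r) (start x)
    simpa using key _ _ p (by simpa using hr)
  refine ⟨?_, r, fun x => ((S.frozen le_rfl hF le_rfl x).1).trans (hall x)⟩
  have hnb : ∀ τ, 4 * B * (4 * D) ≤ τ → τ ≤ 4 * B * (6 * D) → ∀ x, ¬ bad τ x := by
    intro τ hτ
    induction τ, hτ using Nat.le_induction with
    | base => exact fun _ x => hgood x (hall x)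
    | succ τ hle ih =>
      intro hτ x hx
      have hle' : 4 * B * (3 * D) ≤ τ := (Nat.mul_le_mul_left _ (by omega)).trans hle
      rcases S.bad_source τ hτ x hx with h | h | ⟨-, b, h | h⟩
      · exact ih (Nat.le_of_succ_le hτ) x h
      · have hpos : 0 < 4 * B * (4 * D) := by
          have := S.pos_bits
          positivity
        exact hgood x (hall x) (S.bad_mono hpos hH (S.bad_of_deg 0 (by omega) rfl x h))
      · exact ih (Nat.le_of_succ_le hτ) b h
      · have hfr := fun y => (S.frozen le_rfl hle' (Nat.le_of_succ_le hτ) y).1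
        exact h (by rw [hfr, hfr, hall, hall])
  exact hnb _ hH le_rfl

/-- The degrees on a shortest path add up to less than three times the number of nodes, which
bounds the time in which the smallest identifier spreads. -/
theorem best_eq_min [Fintype V] (hG : G.Connected) (hD : Fintype.card V ≤ D) {r : A}
    (hr : ∀ a, ident r ≤ ident a) (d : ℕ) (x : A) (hx : G.dist (start x) (start r) = d) :
    best (4 * B * ({w | G.dist w (start r) < d - 1}.ncard + {w | G.dist w (start r) < d}.ncard +
      {w | G.dist w (start r) < d + 1}.ncard)) x = ident r := by
  set Bl : ℕ → ℕ := fun d => {w | G.dist w (start r) < d}.ncard with hBl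
  change best (4 * B * (Bl (d - 1) + Bl d + Bl (d + 1))) x = ident r
  have hcard : ∀ d, Bl d ≤ D := fun d =>
    (Set.ncard_le_ncard (Set.subset_univ _) (Set.toFinite _)).trans
      (by rwa [Set.ncard_univ, Nat.card_eq_fintype_card])
  have hmin : ∀ τ ≤ 4 * B * (6 * D), ∀ a, ident r ≤ best τ a := by
    intro τ hτ a
    obtain ⟨b, hb⟩ := S.best_eq_ident hτ a
    exact hb ▸ hr b
  have hT : ∀ d, 4 * B * (Bl (d - 1) + Bl d + Bl (d + 1)) ≤ 4 * B * (6 * D) := by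
    intro d
    have h1 := hcard (d - 1)
    have h2 := hcard d
    have h3 := hcard (d + 1)
    exact Nat.mul_le_mul_left _ (by omega)
  induction d generalizing x with
  | zero =>
    obtain rfl : x = r := start.injective ((hG.dist_eq_zero_iff).1 hx)
    exact le_antisymm (S.best_le_ident (hT 0) x) (hmin _ (hT 0) x)
  | succ d ih =>
    obtain ⟨y, hxy, hy⟩ : ∃ y : A, G.Adj (start y) (start x) ∧ G.dist (start y) (start r) = d := by
      obtain ⟨v, h1, h2⟩ := exists_adj_dist_eq hG hx
      exact ⟨start.symm v, by simpa using h1, by simpa using h2⟩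
    -- This inequality makes the time bound telescope: adding the degree of `y` to the three balls
    -- of index `d` gives at most the three balls of index `d + 1`.
    have hdeg : N.deg (start y) + Bl (d - 1) ≤ Bl (d + 2) := by
      have := deg_add_ncard_le (N := N) hG (start r) (start y)
      rwa [hy] at this
    obtain ⟨p, hp⟩ := N.exists_leads_of_adj hxy
    obtain ⟨μ, h1, h2, h3⟩ := exists_mod_eq hp.lt (Bl (d - 1) + Bl d + Bl (d + 1))
    have hne : ident y ≠ ident x := fun h => hxy.ne (congrArg start (S.injective h))
    obtain ⟨τ, h4, h5, h6, h7, h8, h9⟩ :=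
      exists_travels_of_ne (S.ident_lt y) (S.ident_lt x) hne μ
    have hμ : μ + 1 ≤ Bl d + Bl (d + 1) + Bl (d + 2) := by omega
    have h10 : Bl d + Bl (d + 1) + Bl (d + 2) ≤ 3 * D := by
      have h1 := hcard d
      have h2 := hcard (d + 1)
      have h3 := hcard (d + 2)
      omega
    have h11 : τ + 1 ≤ 4 * B * (Bl d + Bl (d + 1) + Bl (d + 2)) :=
      (Nat.succ_le_of_lt h5).trans (Nat.mul_le_mul_left _ hμ)
    have h12 := hT (d + 1)
    simp only [Nat.add_sub_cancel] at h12 ⊢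
    have h13 : τ < 4 * B * (6 * D) := by
      have : 4 * B * (Bl d + Bl (d + 1) + Bl (d + 2)) ≤ 4 * B * (6 * D) := h12
      omega
    have hτy : best τ y ≤ ident r :=
      (S.best_anti ((Nat.mul_le_mul_left _ h1).trans h4) h13.le y).trans (ih y hy).le
    refine le_antisymm ?_ (hmin _ h12 x)
    refine (S.best_anti h11 h12 x).trans ((S.push τ h13 h7 (by omega) x y h8 h9 ?_ ?_).trans hτy)
    · rwa [h6, h3]
    · exact (S.depth_lt_card h13.le y).trans_le hD

/-- Degrees are below `n ≤ D` and everybody knows the minimum from `3 * D` on, so a flag has no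
source. -/
theorem not_bad [Fintype V] (hG : G.Connected) (hD : Fintype.card V ≤ D) (x : A) :
    ¬ bad (4 * B * (6 * D)) x := by
  classical
  have : Nonempty A := ⟨x⟩
  obtain ⟨r, hr⟩ : ∃ r, ∀ a, ident r ≤ ident a :=
    ⟨Function.argmin ident, fun a => Function.argmin_le ident a⟩
  have hall : ∀ τ, 4 * B * (3 * D) ≤ τ → τ ≤ 4 * B * (6 * D) → ∀ y, best τ y = ident r := by
    intro τ h1 h2 y
    refine le_antisymm ?_ ?_
    · refine (S.best_anti ?_ h2 y).trans (S.best_eq_min hG hD hr _ y rfl).le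
      refine le_trans (Nat.mul_le_mul_left _ ?_) h1
      have hcard : ∀ s : Set V, s.ncard ≤ D := fun s =>
        (Set.ncard_le_ncard (Set.subset_univ _) (Set.toFinite _)).trans
          (by rwa [Set.ncard_univ, Nat.card_eq_fintype_card])
      have h3 := hcard {w | G.dist w (start r) < G.dist (start y) (start r) - 1}
      have h4 := hcard {w | G.dist w (start r) < G.dist (start y) (start r)}
      have h5 := hcard {w | G.dist w (start r) < G.dist (start y) (start r) + 1}
      omega
    · obtain ⟨b, hb⟩ := S.best_eq_ident h2 y
      exact hb ▸ hr b
  have hnb : ∀ τ ≤ 4 * B * (6 * D), ∀ y, ¬ bad τ y := by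
    intro τ
    induction τ with
    | zero => exact fun _ y => S.not_bad_zero y
    | succ τ ih =>
      intro hτ y hy
      rcases S.bad_source τ hτ y hy with h | h | ⟨h1, b, h | h⟩
      · exact ih (Nat.le_of_succ_le hτ) y h
      · have := N.deg_lt_card (start y)
        omega
      · exact ih (Nat.le_of_succ_le hτ) b h
      · have h2 : 4 * B * (3 * D) ≤ τ := by
          have := (Nat.le_div_iff_mul_le (by have := S.pos_bits; omega)).1 h1
          linarith
        exact h (by rw [hall τ h2 (Nat.le_of_succ_le hτ), hall τ h2 (Nat.le_of_succ_le hτ)])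
  exact hnb _ le_rfl x

/-- The outputs are correct once all agents know the same smallest identifier. -/
theorem isLeaderWithRootedSpanningTree [Fintype V] {τ : ℕ} (hτ : τ ≤ 4 * B * (6 * D)) {r : A}
    (hr : ∀ x, best τ x = ident r) :
    IsLeaderWithRootedSpanningTree N start ident fun a => ⟨(parent τ a).isNone, parent τ a⟩ := by
  classical
  have hroot : parent τ r = none ∧ depth τ r = 0 := by
    rcases S.parent_cases hτ r with h | ⟨b, q, -, -, h, -⟩
    · exact ⟨h.1, h.2.1⟩
    · rw [hr] at h
      omega
  have hother : ∀ a, a ≠ r → ∃ b q, parent τ a = some q ∧ N.Leads (start a) q (start b) ∧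
      depth τ a = depth τ b + 1 := by
    intro a ha
    rcases S.parent_cases hτ a with h | ⟨b, q, h1, h2, -, -, h3⟩
    · exact absurd (S.injective (h.2.2.symm.trans (hr a))) ha
    · exact ⟨b, q, h1, h2, h3 (by rw [hr, hr])⟩
  choose! par port h1 h2 h3 using hother
  have hne : ∀ v, v ≠ start r → start.symm v ≠ r := by
    rintro v hv rfl
    simp at hv
  obtain ⟨T, hT, htree, hdist⟩ := SimpleGraph.exists_isTree_of_parent (G := G) (start r)
    (fun v => start (par (start.symm v))) (fun v => depth τ (start.symm v)) (by simpa using hroot.2)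
    (fun v hv => by simpa using (h2 _ (hne v hv)).adj) (fun v hv => by simpa using h3 _ (hne v hv))
  refine ⟨r, fun a => hr a ▸ S.best_le_ident hτ a, fun a => ?_, hroot.1, T, hT, htree,
    fun a ha => ?_⟩
  · by_cases ha : a = r
    · simp [ha, hroot.1]
    · simp [ha, h1 a ha]
  · obtain ⟨hlt, hnbr⟩ := h2 a ha
    refine ⟨⟨_, hlt⟩, h1 a ha, ?_⟩
    rw [hnbr]
    simpa using hdist (start a) (start.injective.ne ha)

end

end StageTrace

/-! ### The program and its memory -/

/-- The content of the memory of an agent: its identifier, the number `stage` of the current stage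
and the round `clock` of this stage, the smallest identifier `best` that it knows, its depth and its
parent port in the tree of the owner of `best`, whether the stage has failed, and whether the agent
has terminated. -/
structure Mem where
  ident : ℕ
  stage : ℕ
  clock : ℕ
  best : ℕ
  depth : ℕ
  parent : Option ℕ
  bad : Bool
  halted : Bool

namespace Mem

/-- The memory at the beginning of stage `k`. -/
def fresh (i k : ℕ) : Mem := ⟨i, k, 0, i, 0, none, false, false⟩

/-- This is the schedule and not the location: a root counts as away even when it has no parent port
to leave through. -/
def away (B : ℕ) (s : Mem) : Bool := travels B s.ident s.clock

/-- Processing of the message of an agent with memory `m` that has entered the node through port `e`.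
Messages are exchanged between the agent that is at home and each visitor. At first, the agent at
home learns a smaller identifier from the visitor; later, they compare what they know. -/
def receive (B : ℕ) (s m : Mem) (e : Option ℕ) : Mem :=
  if s.away B = m.away B then s
  else if s.clock / (4 * B) < 3 * 2 ^ s.stage then
    if s.away B = false ∧ m.best < s.best ∧ m.depth < 2 ^ s.stage then
      { s with best := m.best, depth := m.depth + 1, parent := e }
    else s
  else { s with bad := s.bad || m.bad || decide (m.best ≠ s.best) }

/-- In even rounds of a stage, the travelling agents leave their homes, and in odd rounds they return.
After the last round, the agents terminate or start the next stage. -/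
def act (B : ℕ) (v : LocalView) (s : Mem) : Mem × Option ℕ :=
  if s.clock = 4 * B * (6 * 2 ^ s.stage) then
    (if s.bad then fresh s.ident (s.stage + 1) else { s with halted := true }, none)
  else if s.clock % 2 = 0 then
    ({ s with clock := s.clock + 1, bad := s.bad || decide (2 ^ s.stage < v.deg) },
      if s.away B then chosenPort B (2 ^ s.stage) v.deg s.clock s.parent else none)
  else ({ s with clock := s.clock + 1 }, if s.away B then v.entry else none)

def output (s : Mem) : Option AgentOutput :=
  if s.halted then some ⟨s.parent.isNone, s.parent⟩ else none

structure Fits (X : ℕ) (s : Mem) : Prop where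
  ident : s.ident ≤ X
  stage : s.stage ≤ X
  clock : s.clock ≤ X
  best : s.best ≤ X
  depth : s.depth ≤ X
  parent : ∀ p, s.parent = some p → p ≤ X

end Mem

/-- Finite memory with numbers up to `X`. -/
abbrev Cell (X : ℕ) : Type :=
  Fin (X + 1) × Fin (X + 1) × Fin (X + 1) × Fin (X + 1) × Fin (X + 1) × Option (Fin (X + 1)) ×
    Bool × Bool

namespace Cell

variable {X : ℕ}

def decode (s : Cell X) : Mem :=
  ⟨s.1, s.2.1, s.2.2.1, s.2.2.2.1, s.2.2.2.2.1, s.2.2.2.2.2.1.map Fin.val, s.2.2.2.2.2.2.1,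
    s.2.2.2.2.2.2.2⟩

/-- Numbers are reduced modulo `X + 1`, so that `Mem.Fits` is needed for a faithful encoding. -/
def encode (X : ℕ) (s : Mem) : Cell X :=
  (Fin.ofNat _ s.ident, Fin.ofNat _ s.stage, Fin.ofNat _ s.clock, Fin.ofNat _ s.best,
    Fin.ofNat _ s.depth, s.parent.map (Fin.ofNat _), s.bad, s.halted)

theorem fits_decode (s : Cell X) : s.decode.Fits X where
  ident := Fin.is_le _
  stage := Fin.is_le _
  clock := Fin.is_le _
  best := Fin.is_le _
  depth := Fin.is_le _
  parent := by
    intro p hp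
    obtain ⟨q, -, rfl⟩ := Option.map_eq_some_iff.1 hp
    exact Fin.is_le _

theorem decode_encode {s : Mem} (h : s.Fits X) : (encode X s).decode = s := by
  have hmod : ∀ {m : ℕ}, m ≤ X → m % (X + 1) = m := fun hm => Nat.mod_eq_of_lt (Nat.lt_succ_of_le hm)
  have hp : (s.parent.map (Fin.ofNat (X + 1))).map Fin.val = s.parent := by
    cases hs : s.parent with
    | none => rfl
    | some p => simp [hmod (h.parent p hs)]
  cases s
  simp only [encode, decode, Fin.val_ofNat, hmod h.ident, hmod h.stage, hmod h.clock, hmod h.best,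
    hmod h.depth]
  simpa using hp

end Cell

/-- The program with memory for numbers up to `X`, for identifiers of `B` bits. -/
def program (X B : ℕ) : AgentProgram where
  State := Cell X
  fintypeState := inferInstance
  init i := Cell.encode X (Mem.fresh i 0)
  recv _ s m := Cell.encode X (s.decode.receive B m.mem.decode m.entry)
  act v s := ((s.decode.act B v).1 |> Cell.encode X, (s.decode.act B v).2)
  output s := s.decode.output

/-! ### Reading messages in arbitrary order -/

namespace Mem

variable {B : ℕ}

theorem receive_same (s m : Mem) (e : Option ℕ) :
    (s.receive B m e).ident = s.ident ∧ (s.receive B m e).stage = s.stage ∧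
      (s.receive B m e).clock = s.clock ∧ (s.receive B m e).halted = s.halted := by
  unfold receive
  split_ifs <;> exact ⟨rfl, rfl, rfl, rfl⟩

theorem receive_away (s m : Mem) (e : Option ℕ) : (s.receive B m e).away B = s.away B := by
  obtain ⟨h1, -, h2, -⟩ := receive_same (B := B) s m e
  rw [away, h1, h2, away]

theorem fits_receive {X : ℕ} {s m : Mem} {e : Option ℕ} (hs : s.Fits X) (hm : m.Fits X)
    (hX : 2 ^ s.stage ≤ X) (he : ∀ q, e = some q → q ≤ X) : (s.receive B m e).Fits X := by
  unfold receive
  split_ifs with h1 h2 h3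
  · exact hs
  · exact ⟨hs.ident, hs.stage, hs.clock, hm.best, Nat.le_trans h3.2.2 hX, he⟩
  · exact hs
  · exact ⟨hs.ident, hs.stage, hs.clock, hs.best, hs.depth, hs.parent⟩

section

variable {A : Type}

/-- The memory after reading the messages of the agents in `l`. -/
def receiveAll (B : ℕ) (m : A → Mem) (e : A → Option ℕ) (s : Mem) (l : List A) : Mem :=
  l.foldl (fun s b => s.receive B (m b) (e b)) s

variable (m : A → Mem) (e : A → Option ℕ)

theorem receiveAll_same (s : Mem) (l : List A) :
    (s.receiveAll B m e l).ident = s.ident ∧ (s.receiveAll B m e l).stage = s.stage ∧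
      (s.receiveAll B m e l).clock = s.clock ∧ (s.receiveAll B m e l).halted = s.halted := by
  induction l generalizing s with
  | nil => exact ⟨rfl, rfl, rfl, rfl⟩
  | cons b l ih =>
    obtain ⟨h1, h2, h3, h4⟩ := ih (s.receive B (m b) (e b))
    obtain ⟨h5, h6, h7, h8⟩ := receive_same (B := B) s (m b) (e b)
    exact ⟨h1.trans h5, h2.trans h6, h3.trans h7, h4.trans h8⟩

theorem receiveAll_away (s : Mem) (l : List A) :
    (s.receiveAll B m e l).away B = s.away B := by
  obtain ⟨h1, -, h2, -⟩ := receiveAll_same (B := B) m e s l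
  rw [away, h1, h2, away]

/-- `best` only decreases while messages are read, so the final value is below that of every
admissible visitor. The reading order may decide which visitor becomes the parent, but not these
properties. -/
theorem receiveAll_flood (s : Mem) (l : List A) (hs : s.clock / (4 * B) < 3 * 2 ^ s.stage) :
    (s.receiveAll B m e l).bad = s.bad ∧
    (((s.receiveAll B m e l).best = s.best ∧ (s.receiveAll B m e l).depth = s.depth ∧
        (s.receiveAll B m e l).parent = s.parent) ∨
      ∃ b ∈ l, s.away B = false ∧ (m b).away B = true ∧ (m b).best < s.best ∧
        (m b).depth < 2 ^ s.stage ∧ (s.receiveAll B m e l).best = (m b).best ∧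
        (s.receiveAll B m e l).depth = (m b).depth + 1 ∧
        (s.receiveAll B m e l).parent = e b) ∧
    ∀ b ∈ l, s.away B = false → (m b).away B = true → (m b).depth < 2 ^ s.stage →
      (s.receiveAll B m e l).best ≤ (m b).best := by
  induction l generalizing s with
  | nil => exact ⟨rfl, .inl ⟨rfl, rfl, rfl⟩, by simp⟩
  | cons b l ih =>
    have hsame := receive_same (B := B) s (m b) (e b)
    have haway := receive_away (B := B) s (m b) (e b)
    obtain ⟨h1, h2, h3⟩ := ih (s.receive B (m b) (e b)) (by rw [hsame.2.1, hsame.2.2.1]; exact hs)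
    rw [haway, hsame.2.1] at h2
    rw [haway, hsame.2.1] at h3
    change (receiveAll B m e (s.receive B (m b) (e b)) l).bad = s.bad ∧
      (((receiveAll B m e (s.receive B (m b) (e b)) l).best = s.best ∧
        (receiveAll B m e (s.receive B (m b) (e b)) l).depth = s.depth ∧
        (receiveAll B m e (s.receive B (m b) (e b)) l).parent = s.parent) ∨ _) ∧ _
    generalize hR : receiveAll B m e (s.receive B (m b) (e b)) l = R at *
    have hR' : s.receiveAll B m e (b :: l) = R := hR
    rw [hR']
    by_cases hb : s.away B = false ∧ (m b).away B = true ∧ (m b).best < s.best ∧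
        (m b).depth < 2 ^ s.stage
    · obtain ⟨hb1, hb2, hb3, hb4⟩ := hb
      have hrec : s.receive B (m b) (e b) =
          { s with best := (m b).best, depth := (m b).depth + 1, parent := e b } := by
        rw [receive, if_neg (by simp [hb1, hb2]), if_pos hs, if_pos ⟨hb1, hb3, hb4⟩]
      rw [hrec] at h1 h2
      refine ⟨h1, .inr ?_, ?_⟩
      · rcases h2 with h2 | ⟨x, hx, h4, h5, h6, h7⟩
        · exact ⟨b, List.mem_cons_self, hb1, hb2, hb3, hb4, h2⟩
        · exact ⟨x, List.mem_cons_of_mem _ hx, h4, h5, h6.trans hb3, h7⟩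
      · intro x hx h4 h5 h6
        rcases List.mem_cons.1 hx with rfl | hx
        · rcases h2 with h2 | ⟨y, -, -, -, h7, -, h8, -⟩
          · exact h2.1.le
          · exact h8 ▸ h7.le
        · exact h3 x hx h4 h5 h6
    · have hrec : s.receive B (m b) (e b) = s := by
        rw [receive]
        split_ifs with h4 h5
        · rfl
        · refine absurd ⟨h5.1, ?_, h5.2⟩ hb
          simpa [h5.1] using h4
        · rfl
      rw [hrec] at h1 h2
      refine ⟨h1, ?_, ?_⟩
      · rcases h2 with h2 | ⟨x, hx, h4⟩
        · exact .inl h2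
        · exact .inr ⟨x, List.mem_cons_of_mem _ hx, h4⟩
      · intro x hx h4 h5 h6
        rcases List.mem_cons.1 hx with rfl | hx
        · have h7 : s.best ≤ (m x).best := by
            by_contra! h
            exact hb ⟨h4, h5, h, h6⟩
          rcases h2 with h2 | ⟨y, -, -, -, h8, -, h9, -⟩
          · exact h2.1 ▸ h7
          · exact h9 ▸ h8.le.trans h7
        · exact h3 x hx h4 h5 h6

/-- Since `best` stays fixed, every message is tested against the same value, and the flag collects
a disjunction. -/
theorem receiveAll_compare (s : Mem) (l : List A) (hs : 3 * 2 ^ s.stage ≤ s.clock / (4 * B)) :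
    (s.receiveAll B m e l).best = s.best ∧ (s.receiveAll B m e l).depth = s.depth ∧
    (s.receiveAll B m e l).parent = s.parent ∧
    ((s.receiveAll B m e l).bad = true ↔ s.bad = true ∨
      ∃ b ∈ l, s.away B ≠ (m b).away B ∧ ((m b).bad = true ∨ (m b).best ≠ s.best)) := by
  induction l generalizing s with
  | nil => exact ⟨rfl, rfl, rfl, by simp [receiveAll]⟩
  | cons b l ih =>
    have hsame := receive_same (B := B) s (m b) (e b)
    have haway := receive_away (B := B) s (m b) (e b)
    have hb : (s.receive B (m b) (e b)).best = s.best ∧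
        (s.receive B (m b) (e b)).depth = s.depth ∧
        (s.receive B (m b) (e b)).parent = s.parent ∧
        ((s.receive B (m b) (e b)).bad = true ↔ s.bad = true ∨
          (s.away B ≠ (m b).away B ∧ ((m b).bad = true ∨ (m b).best ≠ s.best))) := by
      rw [receive, if_neg (not_lt.2 hs)]
      split_ifs with h
      · simp [h]
      · simp [h, or_assoc]
    obtain ⟨h1, h2, h3, h4⟩ := ih (s.receive B (m b) (e b))
      (by rw [hsame.2.1, hsame.2.2.1]; exact hs)
    refine ⟨h1.trans hb.1, h2.trans hb.2.1, h3.trans hb.2.2.1, h4.trans ?_⟩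
    rw [haway, hb.1, hb.2.2.2, List.exists_mem_cons_iff, or_assoc]

end

end Mem

/-- No intermediate memory overflows, so the bounded memory computes the same as the unbounded one.
-/
theorem decode_foldl {X B : ℕ} {V A : Type} {G : SimpleGraph V} (N : PortNumbering G)
    (c : (program X B).Config V A) (a : A) (l : List A)
    (he : ∀ b ∈ l, ∀ q, c.entry b = some q → q ≤ X)
    (hs : 2 ^ (Cell.decode (c.mem a)).stage ≤ X) :
    Cell.decode (c.memAfterReading N a l) =
      (Cell.decode (c.mem a)).receiveAll B (fun b => Cell.decode (c.mem b)) c.entry l := by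
  unfold AgentProgram.Config.memAfterReading
  generalize c.mem a = s at *
  change Cell X at s
  induction l generalizing s with
  | nil => rfl
  | cons b l ih =>
    have hfit : (Mem.receive B s.decode (Cell.decode (c.mem b)) (c.entry b)).Fits X :=
      Mem.fits_receive s.fits_decode (Cell.fits_decode _) hs (he b List.mem_cons_self)
    have hdec : Cell.decode ((program X B).recv (c.view N a) s (c.message b)) =
      Mem.receive B s.decode (Cell.decode (c.mem b)) (c.entry b) := Cell.decode_encode hfit
    refine (ih (fun b hb => he b (List.mem_cons_of_mem _ hb))
      ((program X B).recv (c.view N a) s (c.message b)) ?_).trans ?_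
    · rw [hdec, (Mem.receive_same _ _ _).2.1]
      exact hs
    · rw [hdec]
      rfl

/-! ### Executions of a stage -/

section Stage

variable {V A : Type} {G : SimpleGraph V} {X B : ℕ}

/-- The memory of agent `a`. -/
def AgentProgram.Config.raw (c : (program X B).Config V A) (a : A) : Mem := Cell.decode (c.mem a)

/-- The configuration `c` occurs in round `τ` of stage `k`. -/
structure InStage (N : PortNumbering G) (start : A ≃ V) (ident : A → ℕ) (k τ : ℕ)
    (c : (program X B).Config V A) : Prop where
  ident_eq : ∀ a, (c.raw a).ident = ident a
  stage_eq : ∀ a, (c.raw a).stage = k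
  clock_eq : ∀ a, (c.raw a).clock = τ
  halted_eq : ∀ a, (c.raw a).halted = false
  home : τ % 2 = 0 → ∀ a, c.pos a = start a
  visit : τ % 2 = 1 → ∀ a, (c.pos a, c.entry a) = N.traverse (start a)
    (if travels B (ident a) τ then chosenPort B (2 ^ k) (N.deg (start a)) τ (c.raw a).parent
      else none)

theorem away_congr {σ τ : ℕ} (h : σ / 2 = τ / 2) (i : ℕ) : travels B i σ = travels B i τ := by
  rw [travels, travels, h, show σ / 4 = τ / 4 by omega]

theorem div_congr {σ τ : ℕ} (h : σ / 2 = τ / 2) : σ / (4 * B) = τ / (4 * B) := by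
  rw [show 4 * B = 2 * (2 * B) by ring, ← Nat.div_div_eq_div_mul, h, Nat.div_div_eq_div_mul]

namespace InStage

variable {N : PortNumbering G} {start : A ≃ V} {ident : A → ℕ} {k τ : ℕ}
  {c c' : (program X B).Config V A}

theorem away (h : InStage N start ident k τ c) (a : A) :
    (c.raw a).away B = travels B (ident a) τ := by
  rw [Mem.away, h.ident_eq, h.clock_eq]

theorem reading (h : InStage N start ident k τ c) (hr : c.Round N c') (a : A) :
    ∃ l : List A, c.IsReadingOrder a l ∧
      c'.mem a = Cell.encode X ((Cell.decode (c.memAfterReading N a l)).act B (c.view N a)).1 ∧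
      (c'.pos a, c'.entry a) = N.traverse (c.pos a)
        ((Cell.decode (c.memAfterReading N a l)).act B (c.view N a)).2 := by
  rcases hr a with ⟨h1, -⟩ | ⟨-, h1⟩
  · refine absurd ?_ h1
    change (c.raw a).output = none
    rw [Mem.output, h.halted_eq]
    rfl
  · exact h1

/-- In even rounds everybody is at home and alone, so there are no messages. -/
theorem reading_of_even (h : InStage N start ident k τ c) (hτ : τ % 2 = 0) (hr : c.Round N c')
    (a : A) :
    c'.mem a = Cell.encode X ((c.raw a).act B (c.view N a)).1 ∧
      (c'.pos a, c'.entry a) = N.traverse (start a) ((c.raw a).act B (c.view N a)).2 := by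
  obtain ⟨l, hl, h1, h2⟩ := h.reading hr a
  obtain rfl : l = [] := by
    refine List.eq_nil_iff_forall_not_mem.2 fun b hb => ?_
    obtain ⟨h3, h4⟩ := (hl.2 b).1 hb
    rw [h.home hτ, h.home hτ] at h4
    exact h3 (start.injective h4)
  rw [h.home hτ a] at h2
  exact ⟨h1, h2⟩

theorem step_even (h : InStage N start ident k τ c) (hτ : τ % 2 = 0)
    (hlt : τ < 4 * B * (6 * 2 ^ k)) (hX : 4 * B * (6 * 2 ^ k) ≤ X) (hr : c.Round N c') :
    InStage N start ident k (τ + 1) c' ∧ ∀ a, c'.raw a =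
      { c.raw a with
        clock := τ + 1, bad := (c.raw a).bad || decide (2 ^ k < N.deg (start a)) } := by
  have hact : ∀ a, (c.raw a).act B (c.view N a) =
      ({ c.raw a with
        clock := τ + 1, bad := (c.raw a).bad || decide (2 ^ k < N.deg (start a)) },
      if travels B (ident a) τ then
        chosenPort B (2 ^ k) (N.deg (start a)) τ (c.raw a).parent else none) := by
    intro a
    rw [Mem.act, h.clock_eq, h.stage_eq, if_neg hlt.ne, if_pos hτ, h.away]
    simp only [AgentProgram.Config.view, h.home hτ, h.stage_eq]
  have hraw : ∀ a, c'.raw a = { c.raw a with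
        clock := τ + 1, bad := (c.raw a).bad || decide (2 ^ k < N.deg (start a)) } := by
    intro a
    have h1 := (h.reading_of_even hτ hr a).1
    have hf : (c.raw a).Fits X := Cell.fits_decode _
    rw [hact] at h1
    rw [AgentProgram.Config.raw, h1]
    exact Cell.decode_encode ⟨hf.ident, hf.stage, by dsimp only; omega, hf.best, hf.depth, hf.parent⟩
  refine ⟨⟨fun a => ?_, fun a => ?_, fun a => ?_, fun a => ?_, fun h1 => by omega,
    fun _ a => ?_⟩, hraw⟩
  · rw [hraw]; exact h.ident_eq a
  · rw [hraw]; exact h.stage_eq a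
  · rw [hraw]
  · rw [hraw]; exact h.halted_eq a
  · rw [(h.reading_of_even hτ hr a).2, hact, hraw, away_congr (σ := τ + 1) (τ := τ) (by omega),
      chosenPort, chosenPort, div_congr (σ := τ + 1) (τ := τ) (by omega)]

/-- The first case includes agents that are scheduled to travel but have no valid port, such as a
root in the last third or the only node of a trivial graph. -/
theorem home_or_leads (h : InStage N start ident k τ c) (hτ : τ % 2 = 1) (a : A) :
    (c.pos a = start a ∧ c.entry a = none) ∨
    ∃ p q, travels B (ident a) τ = true ∧
      chosenPort B (2 ^ k) (N.deg (start a)) τ (c.raw a).parent = some p ∧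
      N.Leads (start a) p (c.pos a) ∧ c.entry a = some q ∧ N.Leads (c.pos a) q (start a) ∧
      N.traverse (c.pos a) (some q) = (start a, some p) := by
  have hv := h.visit hτ a
  rcases N.traverse_eq_or (start a) (if travels B (ident a) τ then
    chosenPort B (2 ^ k) (N.deg (start a)) τ (c.raw a).parent else none) with h1 | ⟨p, w, h1, h2⟩
  · rw [h1, Prod.mk.injEq] at hv
    exact .inl hv
  · rw [h1] at hv
    obtain ⟨q, h3, h4, h5⟩ := h2.traverse
    rw [h3, Prod.mk.injEq] at hv
    obtain ⟨h6, h7⟩ := hv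
    subst h6
    rcases htr : travels B (ident a) τ with _ | _
    · simp [htr] at h1
    · rw [if_pos htr] at h1
      exact .inr ⟨p, q, rfl, h1, h2, h7, h4, h5⟩

theorem step_odd [Fintype V] (h : InStage N start ident k τ c) (hτ : τ % 2 = 1)
    (hlt : τ < 4 * B * (6 * 2 ^ k)) (hX : 4 * B * (6 * 2 ^ k) ≤ X) (hV : Fintype.card V ≤ X)
    (hr : c.Round N c') :
    InStage N start ident k (τ + 1) c' ∧ ∀ a, ∃ l, c.IsReadingOrder a l ∧
      c'.raw a = { (c.raw a).receiveAll B c.raw c.entry l with clock := τ + 1 } := by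
  have hB : 0 < B := by
    rcases Nat.eq_zero_or_pos B with rfl | hB
    · simp at hlt
    · exact hB
  have hkX : 2 ^ k ≤ X := by
    have : 1 * 2 ^ k ≤ 4 * B * (6 * 2 ^ k) := by
      rw [← mul_assoc]
      exact Nat.mul_le_mul_right _ (by omega)
    omega
  have main : ∀ a, ∃ l, c.IsReadingOrder a l ∧
      c'.raw a = { (c.raw a).receiveAll B c.raw c.entry l with clock := τ + 1 } ∧
      c'.pos a = start a := by
    intro a
    obtain ⟨l, hl, h1, h2⟩ := h.reading hr a
    have hfold : Cell.decode (c.memAfterReading N a l) =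
        (c.raw a).receiveAll B c.raw c.entry l := by
      -- Entry ports are below a degree, hence below the number of nodes, and fit into the memory.
      refine decode_foldl N c a l (fun b _ q hq => ?_) ((h.stage_eq a).symm ▸ hkX)
      rcases h.home_or_leads hτ b with ⟨-, h3⟩ | ⟨p, q', -, -, -, h3, h4, -⟩
      · simp [h3] at hq
      · rw [h3, Option.some_inj] at hq
        have := h4.lt
        have := N.deg_lt_card (c.pos b)
        omega
    obtain ⟨-, h4, h5, -⟩ := Mem.receiveAll_same (B := B) c.raw c.entry (c.raw a) l
    have hact : ((c.raw a).receiveAll B c.raw c.entry l).act B (c.view N a) =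
        ({ (c.raw a).receiveAll B c.raw c.entry l with clock := τ + 1 },
        if travels B (ident a) τ then c.entry a else none) := by
      rw [Mem.act, h5, h4, h.clock_eq, h.stage_eq, if_neg hlt.ne, if_neg (by omega), Mem.receiveAll_away,
        h.away]
      simp only [h4, h.stage_eq]
      rfl
    have hf : ((c.raw a).receiveAll B c.raw c.entry l).Fits X := hfold ▸ Cell.fits_decode _
    rw [hfold, hact] at h1 h2
    refine ⟨l, hl, ?_, ?_⟩
    · rw [AgentProgram.Config.raw, h1]
      exact Cell.decode_encode
        ⟨hf.ident, hf.stage, by dsimp only; omega, hf.best, hf.depth, hf.parent⟩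
    · rcases h.home_or_leads hτ a with ⟨h6, h7⟩ | ⟨p, q, h6, -, -, h7, -, h8⟩
      · rw [h7, ite_self, h6] at h2
        exact congrArg Prod.fst h2
      · rw [if_pos h6, h7, h8] at h2
        exact congrArg Prod.fst h2
  have hsame := fun a l => Mem.receiveAll_same (B := B) c.raw c.entry (c.raw a) l
  refine ⟨⟨fun a => ?_, fun a => ?_, fun a => ?_, fun a => ?_, fun _ a => ?_,
    fun h1 => by omega⟩, fun a => (main a).imp fun l hl => ⟨hl.1, hl.2.1⟩⟩
  all_goals obtain ⟨l, -, hl, hl'⟩ := main a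
  · rw [hl]; exact (hsame a l).1.trans (h.ident_eq a)
  · rw [hl]; exact (hsame a l).2.1.trans (h.stage_eq a)
  · rw [hl]
  · rw [hl]; exact (hsame a l).2.2.2.trans (h.halted_eq a)
  · exact hl'

/-- The stage length is even, so the decision is taken at home. -/
theorem finish (h : InStage N start ident k (4 * B * (6 * 2 ^ k)) c) (hk : k + 1 ≤ X)
    (hr : c.Round N c') (a : A) :
    c'.raw a = (if (c.raw a).bad then Mem.fresh (ident a) (k + 1)
      else { c.raw a with halted := true }) ∧ c'.pos a = start a := by
  have heven : 4 * B * (6 * 2 ^ k) % 2 = 0 := by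
    rw [show 4 * B * (6 * 2 ^ k) = 2 * (2 * B * (6 * 2 ^ k)) by ring, Nat.mul_mod_right]
  have hact : (c.raw a).act B (c.view N a) = (if (c.raw a).bad then Mem.fresh (ident a) (k + 1)
      else { c.raw a with halted := true }, none) := by
    rw [Mem.act, h.clock_eq, h.stage_eq, if_pos rfl, h.ident_eq]
    simp only [h.ident_eq, h.stage_eq, h.clock_eq]
  have hf : (c.raw a).Fits X := Cell.fits_decode _
  obtain ⟨h1, h2⟩ := h.reading_of_even heven hr a
  rw [hact] at h1 h2
  refine ⟨?_, congrArg Prod.fst h2⟩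
  rw [AgentProgram.Config.raw, h1]
  refine Cell.decode_encode ?_
  split_ifs
  · have hi : ident a ≤ X := h.ident_eq a ▸ hf.ident
    exact ⟨hi, hk, Nat.zero_le _, hi, Nat.zero_le _, by simp [Mem.fresh]⟩
  · exact ⟨hf.ident, hf.stage, hf.clock, hf.best, hf.depth, hf.parent⟩

end InStage

/-- The configuration `c` occurs at the beginning of stage `k`. -/
def StartsStage (start : A ≃ V) (ident : A → ℕ) (k : ℕ) (c : (program X B).Config V A) : Prop :=
  ∀ a, c.raw a = Mem.fresh (ident a) k ∧ c.pos a = start a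

variable {N : PortNumbering G} {start : A ≃ V} {ident : A → ℕ} {k : ℕ}
  {c : ℕ → (program X B).Config V A}

theorem StartsStage.inStage {c : (program X B).Config V A} (h : StartsStage start ident k c) :
    InStage N start ident k 0 c where
  ident_eq a := by rw [(h a).1]; rfl
  stage_eq a := by rw [(h a).1]; rfl
  clock_eq a := by rw [(h a).1]; rfl
  halted_eq a := by rw [(h a).1]; rfl
  home _ a := (h a).2
  visit h1 := by simp at h1

variable [Fintype V]

theorem StartsStage.inStage_add (h : StartsStage start ident k (c 0))
    (hr : ∀ t, (c t).Round N (c (t + 1))) (hX : 4 * B * (6 * 2 ^ k) ≤ X)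
    (hV : Fintype.card V ≤ X) (τ : ℕ) (hτ : τ ≤ 4 * B * (6 * 2 ^ k)) :
    InStage N start ident k τ (c τ) := by
  induction τ with
  | zero => exact h.inStage
  | succ τ ih =>
    rcases Nat.mod_two_eq_zero_or_one τ with h1 | h1
    · exact ((ih (by omega)).step_even h1 hτ hX (hr τ)).1
    · exact ((ih (by omega)).step_odd h1 hτ hX hV (hr τ)).1

theorem StartsStage.trace (h : StartsStage start ident k (c 0))
    (hr : ∀ t, (c t).Round N (c (t + 1))) (hX : 4 * B * (6 * 2 ^ k) ≤ X)
    (hV : Fintype.card V ≤ X) (hB : 0 < B) (hident : ∀ a, ident a < 2 ^ B)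
    (hinj : Function.Injective ident) :
    StageTrace N start ident B (2 ^ k) (fun τ a => ((c τ).raw a).best)
      (fun τ a => ((c τ).raw a).depth) (fun τ a => ((c τ).raw a).parent)
      (fun τ a => ((c τ).raw a).bad = true) := by
  have hin := fun τ (hτ : τ < 4 * B * (6 * 2 ^ k)) => h.inStage_add hr hX hV τ hτ.le
  have heven := fun τ hτ h2 => ((hin τ hτ).step_even h2 hτ hX (hr τ)).2
  have hodd := fun τ hτ h2 => ((hin τ hτ).step_odd h2 hτ hX hV (hr τ)).2
  have hmeet : ∀ τ < 4 * B * (6 * 2 ^ k), τ % 2 = 1 → ∀ a b p, travels B (ident a) τ = true →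
      travels B (ident b) τ = false →
      chosenPort B (2 ^ k) (N.deg (start a)) τ ((c τ).raw a).parent = some p →
      N.Leads (start a) p (start b) → (c τ).pos a = (c τ).pos b := by
    intro τ hτ h2 a b p ha hb hp hl
    have h3 := (hin τ hτ).visit h2 a
    have h4 : (c τ).pos b = start b := by
      simpa [hb, PortNumbering.traverse] using congrArg Prod.fst ((hin τ hτ).visit h2 b)
    obtain ⟨q, hq, -⟩ := hl.traverse
    rw [if_pos ha, hp, hq, Prod.mk.injEq] at h3
    rw [h3.1, h4]
  have hne : ∀ {τ : ℕ} {a b : A}, travels B (ident a) τ = true → travels B (ident b) τ = false →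
      a ≠ b := by
    rintro τ a _ h1 h2 rfl
    simp [h1] at h2
  refine
    { ident_lt := hident
      injective := hinj
      pos_bits := hB
      best_zero := fun a => by rw [(h a).1]; rfl
      depth_zero := fun a => by rw [(h a).1]; rfl
      parent_zero := fun a => by rw [(h a).1]; rfl
      not_bad_zero := fun a => by rw [(h a).1]; simp [Mem.fresh]
      same := ?_, flood := ?_, push := ?_, bad_succ := ?_, bad_of_deg := ?_, bad_source := ?_
      bad_meet := ?_ }
  · intro τ hτ h1 a
    rcases Nat.mod_two_eq_zero_or_one τ with h2 | h2
    · rw [heven τ hτ h2 a]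
      exact ⟨rfl, rfl, rfl⟩
    · obtain ⟨l, -, hl⟩ := hodd τ hτ h2 a
      obtain ⟨h3, h4, h5, -⟩ := Mem.receiveAll_compare (B := B) (c τ).raw (c τ).entry
        ((c τ).raw a) l (by rw [(hin τ hτ).stage_eq, (hin τ hτ).clock_eq]; omega)
      rw [hl]
      exact ⟨h3, h4, h5⟩
  · intro τ hτ h2 h1 a
    obtain ⟨l, hl', hl⟩ := hodd τ hτ h2 a
    obtain ⟨-, h3, -⟩ := Mem.receiveAll_flood (B := B) (c τ).raw (c τ).entry
        ((c τ).raw a) l (by rw [(hin τ hτ).stage_eq, (hin τ hτ).clock_eq]; exact h1)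
    rw [hl]
    refine h3.imp id ?_
    rintro ⟨b, hb, h4, h5, h6, h7, h8, h9, h10⟩
    obtain ⟨hba, hpos⟩ := (hl'.2 b).1 hb
    rw [(hin τ hτ).away] at h4
    have hpa : (c τ).pos a = start a := by
      rcases (hin τ hτ).home_or_leads h2 a with h11 | ⟨p, q, h11, -⟩
      · exact h11.1
      · simp [h4] at h11
    -- The sender is a visitor, and the port through which it entered leads from the home of `a`
    -- back to its own home: a valid parent port.
    rcases (hin τ hτ).home_or_leads h2 b with h11 | ⟨p, q, -, -, -, h11, h12, -⟩
    · exact absurd (start.injective (h11.1.symm.trans (hpos.trans hpa))) hba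
    · rw [hpos, hpa] at h12
      exact ⟨b, q, h12, h6, (hin τ hτ).stage_eq a ▸ h7, h8, h9, h10.trans h11⟩
  · intro τ hτ h2 h1 a b hb ha hl hd
    obtain ⟨l, hl', hl''⟩ := hodd τ hτ h2 a
    obtain ⟨-, -, h3⟩ := Mem.receiveAll_flood (B := B) (c τ).raw (c τ).entry
        ((c τ).raw a) l (by rw [(hin τ hτ).stage_eq, (hin τ hτ).clock_eq]; exact h1)
    have hpos := hmeet τ hτ h2 b a _ hb ha (by rw [chosenPort, if_pos (by omega)]) hl
    change ((c (τ + 1)).raw a).best ≤ _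
    rw [hl'']
    exact h3 b ((hl'.2 b).2 ⟨hne hb ha, hpos⟩) (by rw [(hin τ hτ).away, ha])
      (by rw [(hin τ hτ).away, hb]) (by rw [(hin τ hτ).stage_eq]; exact hd)
  · intro τ hτ a ha
    rcases Nat.mod_two_eq_zero_or_one τ with h2 | h2
    · rw [heven τ hτ h2 a]
      simp [ha]
    · obtain ⟨l, -, hl⟩ := hodd τ hτ h2 a
      rw [hl]
      rcases Nat.lt_or_ge (τ / (4 * B)) (3 * 2 ^ k) with h1 | h1
      · exact (Mem.receiveAll_flood (B := B) (c τ).raw (c τ).entry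
          ((c τ).raw a) l (by rw [(hin τ hτ).stage_eq, (hin τ hτ).clock_eq]; exact h1)).1.trans ha
      · exact (Mem.receiveAll_compare (B := B) (c τ).raw (c τ).entry
          ((c τ).raw a) l (by rw [(hin τ hτ).stage_eq, (hin τ hτ).clock_eq]; exact h1)).2.2.2.2 (.inl ha)
  · intro τ hτ h2 a ha
    rw [heven τ hτ h2 a]
    simp [ha]
  · intro τ hτ a ha
    rcases Nat.mod_two_eq_zero_or_one τ with h2 | h2
    · rw [heven τ hτ h2 a] at ha
      simp only [Bool.or_eq_true, decide_eq_true_eq] at ha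
      exact ha.imp id .inl
    · obtain ⟨l, -, hl⟩ := hodd τ hτ h2 a
      rw [hl] at ha
      rcases Nat.lt_or_ge (τ / (4 * B)) (3 * 2 ^ k) with h1 | h1
      · exact .inl ((Mem.receiveAll_flood (B := B) (c τ).raw (c τ).entry
          ((c τ).raw a) l (by rw [(hin τ hτ).stage_eq, (hin τ hτ).clock_eq]; exact h1)).1.symm.trans ha)
      · rcases (Mem.receiveAll_compare (B := B) (c τ).raw (c τ).entry
          ((c τ).raw a) l (by rw [(hin τ hτ).stage_eq, (hin τ hτ).clock_eq]; exact h1)).2.2.2.1 ha with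
          h3 | ⟨b, -, -, h3⟩
        · exact .inl h3
        · exact .inr (.inr ⟨h1, b, h3⟩)
  · intro τ hτ h2 h1 a b p ha hb hp hl
    have hpos := hmeet τ hτ h2 a b p ha hb hp hl
    have key : ∀ x y, travels B (ident x) τ ≠ travels B (ident y) τ → (c τ).pos y = (c τ).pos x →
        ((c τ).raw y).bad = true ∨ ((c τ).raw y).best ≠ ((c τ).raw x).best →
        ((c (τ + 1)).raw x).bad = true := by
      intro x y hxy hpos h4
      obtain ⟨l, hl', hl⟩ := hodd τ hτ h2 x
      rw [hl]
      refine (Mem.receiveAll_compare (B := B) (c τ).raw (c τ).entry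
          ((c τ).raw x) l (by rw [(hin τ hτ).stage_eq, (hin τ hτ).clock_eq]; exact h1)).2.2.2.2
          (.inr ⟨y, (hl'.2 y).2 ⟨?_, hpos⟩, ?_, h4⟩)
      · rintro rfl
        exact hxy rfl
      · rwa [(hin τ hτ).away, (hin τ hτ).away]
    exact ⟨key a b (by simp [ha, hb]) hpos.symm, key b a (by simp [ha, hb]) hpos⟩

/-- After a stage, either all agents have terminated with correct outputs, or all of them start the
next stage; the latter is impossible if `2 ^ k` is at least the number of nodes. -/
theorem StartsStage.outcome (hG : G.Connected) (h : StartsStage start ident k (c 0))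
    (hr : ∀ t, (c t).Round N (c (t + 1))) (hX : 4 * B * (6 * 2 ^ k) ≤ X)
    (hV : Fintype.card V ≤ X) (hB : 0 < B) (hident : ∀ a, ident a < 2 ^ B)
    (hinj : Function.Injective ident) (hk : k + 1 ≤ X) :
    (∃ out : A → AgentOutput, (∀ a,
      (program X B).output ((c (4 * B * (6 * 2 ^ k) + 1)).mem a) = some (out a) ∧
        (c (4 * B * (6 * 2 ^ k) + 1)).pos a = start a) ∧
      IsLeaderWithRootedSpanningTree N start ident out) ∨
    (2 ^ k < Fintype.card V ∧ StartsStage start ident (k + 1) (c (4 * B * (6 * 2 ^ k) + 1))) := by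
  have S := h.trace hr hX hV hB hident hinj
  have hfin := (h.inStage_add hr hX hV _ le_rfl).finish hk (hr _)
  by_cases hbad : ∃ v, ((c (4 * B * (6 * 2 ^ k))).raw v).bad = false
  · obtain ⟨v, hv⟩ := hbad
    obtain ⟨hall, r, hroot⟩ := S.of_not_bad hG (by positivity) (v := v) (by simp [hv])
    refine .inl ⟨_, fun a => ⟨?_, (hfin a).2⟩, S.isLeaderWithRootedSpanningTree le_rfl hroot⟩
    change ((c (4 * B * (6 * 2 ^ k) + 1)).raw a).output = _
    rw [(hfin a).1, if_neg (hall a)]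
    rfl
  · simp only [not_exists, Bool.not_eq_false] at hbad
    refine .inr ⟨?_, fun a => ⟨?_, (hfin a).2⟩⟩
    · by_contra! hle
      obtain ⟨v⟩ := hG.nonempty
      exact S.not_bad hG hle (start.symm v) (hbad _)
    · rw [(hfin a).1, if_pos (hbad a)]

end Stage

/-! ### Running time and memory -/

/-- The numbers that an agent stores are at most `numberBound lam`. -/
def numberBound (lam : ℕ) : ℕ := 64 * (lam + 2) ^ 2

theorem le_numberBound (lam : ℕ) : 64 * (lam + 1) * (lam + 1) + 64 * (lam + 1) ≤ numberBound lam := by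
  rw [numberBound]
  nlinarith

/-- The number of bits of an identifier. -/
def bitLength (lam : ℕ) : ℕ := Nat.log 2 lam + 1

theorem bitLength_le (lam : ℕ) : bitLength lam ≤ lam + 1 :=
  Nat.succ_le_succ (Nat.log_le_self 2 lam)

theorem lt_two_pow_bitLength {i lam : ℕ} (h : i ≤ lam) : i < 2 ^ bitLength lam :=
  h.trans_lt (Nat.lt_pow_succ_log_self one_lt_two lam)

theorem bitLength_mul_log_two_le (lam : ℕ) :
    (bitLength lam : ℝ) * Real.log 2 ≤ 2 * Real.log (lam + 2) := by
  have h1 : ((2 : ℝ) ^ Nat.log 2 lam) ≤ lam + 2 := by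
    have := Nat.pow_log_le_add_one 2 lam
    exact_mod_cast this.trans (Nat.le_succ _)
  have h2 := Real.log_le_log (by positivity) h1
  have h3 : Real.log 2 ≤ Real.log (lam + 2) := 
    Real.log_le_log (by norm_num) (by linarith [Nat.cast_nonneg (α := ℝ) lam])
  rw [Real.log_pow] at h2
  rw [bitLength]
  push_cast
  linarith

theorem exists_outcome {V A : Type} [Fintype V] {G : SimpleGraph V} (hG : G.Connected)
    (N : PortNumbering G) (start : A ≃ V) (ident : A → ℕ) (hinj : Function.Injective ident)
    {lam X B : ℕ} (hlam : ∀ a, ident a ≤ lam) (hBpos : 0 < B) (hBle : B ≤ lam + 1)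
    (hident : ∀ a, ident a < 2 ^ B) (hXle : 64 * (lam + 1) * (lam + 1) + 64 * (lam + 1) ≤ X)
    (c : ℕ → (program X B).Config V A) (hc : (program X B).IsExecution N start ident c) :
    ∃ t ≤ 100 * B * Fintype.card V, ∃ out : A → AgentOutput,
      (∀ a, (program X B).output ((c t).mem a) = some (out a) ∧ (c t).pos a = start a) ∧
        IsLeaderWithRootedSpanningTree N start ident out := by
  set n := Fintype.card V with hn
  have hnpos : 0 < n := by
    have := hG.nonempty
    exact Fintype.card_pos
  have hnle : n ≤ lam + 1 := by
    have : Function.Injective fun v => (⟨ident (start.symm v), Nat.lt_succ_of_le (hlam _)⟩ :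
        Fin (lam + 1)) := fun v w h =>
      start.symm.injective (hinj (Fin.mk.inj_iff.1 h))
    simpa using Fintype.card_le_of_injective _ this
  -- A stage takes `24 * B * 2 ^ k + 1 ≤ 25 * B * 2 ^ k` rounds, so the total time at most doubles.
  -- With `2 ^ k < 2 * n` and `n ≤ lam + 1`, the clock stays within `X`.
  have hstep : ∀ k t, 2 ^ k < 2 * n → t ≤ 25 * B * 2 ^ k → StartsStage start ident k (c t) →
      ∃ t' ≤ 25 * B * 2 ^ (k + 1), (∃ out : A → AgentOutput,
        (∀ a, (program X B).output ((c t').mem a) = some (out a) ∧ (c t').pos a = start a) ∧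
          IsLeaderWithRootedSpanningTree N start ident out) ∨
        (2 ^ k < n ∧ StartsStage start ident (k + 1) (c t')) := by
    intro k t hk ht hs
    have h1 : B * 2 ^ k ≤ (lam + 1) * (2 * (lam + 1)) := Nat.mul_le_mul hBle (by omega)
    have h2 : 1 * 1 ≤ B * 2 ^ k := Nat.mul_le_mul hBpos Nat.one_le_two_pow
    have h3 : k < 2 ^ k := Nat.lt_two_pow_self
    refine ⟨t + (4 * B * (6 * 2 ^ k) + 1), ?_, ?_⟩
    · rw [pow_succ]
      nlinarith
    · exact StartsStage.outcome (c := fun s => c (t + s)) hG hs (fun s => hc.2 (t + s))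
        (by nlinarith) (hnle.trans (by nlinarith)) hBpos
        hident hinj (by nlinarith)
  have hreach : ∀ k, 2 ^ k < 2 * n → (∃ t ≤ 25 * B * 2 ^ k, ∃ out : A → AgentOutput,
        (∀ a, (program X B).output ((c t).mem a) = some (out a) ∧ (c t).pos a = start a) ∧
          IsLeaderWithRootedSpanningTree N start ident out) ∨
        ∃ t ≤ 25 * B * 2 ^ k, StartsStage start ident k (c t) := by
    intro k
    induction k with
    | zero =>
      refine fun _ => .inr ⟨0, Nat.zero_le _, fun a => ?_⟩
      rw [hc.1]
      refine ⟨Cell.decode_encode ?_, rfl⟩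
      have : ident a ≤ X := (hlam a).trans (by nlinarith)
      exact ⟨this, Nat.zero_le _, Nat.zero_le _, this, Nat.zero_le _, by simp [Mem.fresh]⟩
    | succ k ih =>
      intro hk
      rw [pow_succ] at hk
      have hmono : 25 * B * 2 ^ k ≤ 25 * B * 2 ^ (k + 1) :=
        Nat.mul_le_mul_left _ (Nat.pow_le_pow_right (by norm_num) (Nat.le_succ k))
      rcases ih (by omega) with ⟨t, ht, h⟩ | ⟨t, ht, h⟩
      · exact .inl ⟨t, ht.trans hmono, h⟩
      · obtain ⟨t', ht', h' | h'⟩ := hstep k t (by omega) ht h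
        · exact .inl ⟨t', ht', h'⟩
        · exact .inr ⟨t', ht', h'.2⟩
  -- Stage `k` for this power of two cannot fail, and it ends by round `25 * B * 2 ^ (k + 1) ≤ 100 *
  -- B * n`.
  obtain ⟨k, hk1, hk2⟩ : ∃ k, n ≤ 2 ^ k ∧ 2 ^ k < 2 * n := by
    have h1 := Nat.pow_log_le_self 2 (x := 2 * n - 1) (by omega)
    have h2 := Nat.lt_pow_succ_log_self (b := 2) one_lt_two (2 * n - 1)
    rw [pow_succ] at h2
    exact ⟨Nat.log 2 (2 * n - 1), by omega, by omega⟩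
  have hend : 25 * B * 2 ^ (k + 1) ≤ 100 * B * n := by
    rw [pow_succ]
    nlinarith
  have hmono : 25 * B * 2 ^ k ≤ 25 * B * 2 ^ (k + 1) :=
    Nat.mul_le_mul_left _ (Nat.pow_le_pow_right (by norm_num) (Nat.le_succ k))
  rcases hreach k hk2 with ⟨t, ht, h⟩ | ⟨t, ht, h⟩
  · exact ⟨t, ht.trans (hmono.trans hend), h⟩
  · obtain ⟨t', ht', h' | h'⟩ := hstep k t hk2 ht h
    · exact ⟨t', ht'.trans hend, h'⟩
    · omega

/-- Six numbers, the optional parent port included, take at most `11 + 2 * (N * k)` bits each, and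
the two flags add `2`. -/
theorem memoryBits_program_le {lam N k : ℕ} (h : lam ≤ 2 ^ (N * k)) :
    (program (numberBound lam) (bitLength lam)).memoryBits ≤ 68 + 12 * (N * k) := by
  change Nat.clog 2 (Fintype.card (Cell (numberBound lam))) ≤ _
  refine Nat.clog_le_of_le_pow ?_
  have h1 : lam + 2 ≤ 2 ^ (N * k + 2) := by
    have : 1 ≤ 2 ^ (N * k) := Nat.one_le_two_pow
    rw [pow_add]
    omega
  have h2 : numberBound lam + 2 ≤ 2 ^ (11 + 2 * (N * k)) := by
    have h3 : (lam + 2) ^ 2 ≤ (2 ^ (N * k + 2)) ^ 2 := Nat.pow_le_pow_left h1 2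
    have h4 : 2 ^ (11 + 2 * (N * k)) = 128 * (2 ^ (N * k + 2)) ^ 2 := by ring
    rw [h4, numberBound]
    nlinarith
  have h5 : Fintype.card (Cell (numberBound lam)) =
      (numberBound lam + 1) ^ 5 * (numberBound lam + 2) * 4 := by
    simp only [Fintype.card_prod, Fintype.card_fin, Fintype.card_option, Fintype.card_bool]
    ring
  calc Fintype.card (Cell (numberBound lam))
      ≤ (2 ^ (11 + 2 * (N * k))) ^ 5 * 2 ^ (11 + 2 * (N * k)) * 4 := by
        rw [h5]
        gcongr
        omega
    _ = 2 ^ (68 + 12 * (N * k)) := by ring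

/-- `alg lam` is the program of agents that know the bound `lam` on the identifiers and nothing else
about the network. In the logarithms, `lam + 2` and `n + 1` only exclude vanishing bounds for
`lam ≤ 1` and `n = 1`. -/
theorem theorem1 :
    ∃ alg : ℕ → AgentProgram,
      (∃ C : ℝ, ∀ (V A : Type) [Fintype V] (G : SimpleGraph V), G.Connected →
        ∀ (N : PortNumbering G) (start : A ≃ V) (ident : A → ℕ), Function.Injective ident →
        ∀ lam : ℕ, (∀ a, ident a ≤ lam) →
        ∀ c : ℕ → (alg lam).Config V A, (alg lam).IsExecution N start ident c →
        ∃ t : ℕ, (t : ℝ) ≤ C * Fintype.card V * Real.log (lam + 2) ∧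
          ∃ out : A → AgentOutput,
            (∀ a, (alg lam).output ((c t).mem a) = some (out a) ∧ (c t).pos a = start a) ∧
            IsLeaderWithRootedSpanningTree N start ident out) ∧
      (∀ k : ℕ, ∃ M : ℝ, ∀ n lam : ℕ, 1 ≤ n → lam ≤ (n + 1) ^ k →
        ((alg lam).memoryBits : ℝ) ≤ M * Real.log (n + 1)) := by
  have hlog2 : 0 < Real.log 2 := Real.log_pos one_lt_two
  refine ⟨fun lam => program (numberBound lam) (bitLength lam), ⟨200 / Real.log 2, ?_⟩,
    fun k => ⟨(68 + 24 * k) / Real.log 2, ?_⟩⟩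
  · intro V A _ G hG N start ident hinj lam hlam c hc
    obtain ⟨t, ht, h⟩ := exists_outcome hG N start ident hinj hlam
      (Nat.succ_pos (Nat.log 2 lam)) (bitLength_le lam) (fun a => lt_two_pow_bitLength (hlam a))
      (le_numberBound lam) c hc
    refine ⟨t, ?_, h⟩
    have h1 : (t : ℝ) ≤ 100 * bitLength lam * Fintype.card V := by exact_mod_cast ht
    have h2 : (bitLength lam : ℝ) ≤ 2 * Real.log (lam + 2) / Real.log 2 :=
      (le_div_iff₀ hlog2).2 (bitLength_mul_log_two_le lam)
    calc (t : ℝ) ≤ 100 * bitLength lam * Fintype.card V := h1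
      _ ≤ 100 * (2 * Real.log (lam + 2) / Real.log 2) * Fintype.card V := by gcongr
      _ = 200 / Real.log 2 * Fintype.card V * Real.log (lam + 2) := by ring
  · intro n lam hn hlam
    obtain ⟨N, h1, h2⟩ : ∃ N, 2 ^ N ≤ n + 1 ∧ n + 1 ≤ 2 ^ (N + 1) :=
      ⟨Nat.log 2 (n + 1), Nat.pow_log_le_self 2 (by omega),
        (Nat.lt_pow_succ_log_self one_lt_two _).le⟩
    have h3 : lam ≤ 2 ^ ((N + 1) * k) := by
      rw [pow_mul]
      exact hlam.trans (Nat.pow_le_pow_left h2 k)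
    have h4 : ((program (numberBound lam) (bitLength lam)).memoryBits : ℝ) ≤
        68 + 12 * ((N + 1) * k) := by exact_mod_cast memoryBits_program_le h3
    have h5 : N * Real.log 2 ≤ Real.log (n + 1) := by
      rw [← Real.log_pow]
      exact Real.log_le_log (by positivity) (by exact_mod_cast h1)
    have h6 : Real.log 2 ≤ Real.log (n + 1) :=
      Real.log_le_log (by norm_num) (by norm_cast; omega)
    rw [div_mul_eq_mul_div, le_div_iff₀ hlog2]
    calc _ ≤ (68 + 12 * ((N + 1) * k)) * Real.log 2 := by gcongr
      _ = 68 * Real.log 2 + 12 * k * (N * Real.log 2 + Real.log 2) := by ring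
      _ ≤ 68 * Real.log (n + 1) + 12 * k * (Real.log (n + 1) + Real.log (n + 1)) := by gcongr
      _ = (68 + 24 * k) * Real.log (n + 1) := by ring
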